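/- Let $K$ be a locally finite simplicial complex (every vertex lies in finitely many simplices), with polyhedron $|K|$ carrying the coherent topology, and let $\epsilon\in\mathcal{C}^0(K;\mathbb{Z}/2\mathbb{Z})$, i.e. a labelling of the vertices of $K$ by $0$ and $1$. Let $V_\epsilon$ be the subcomplex of the first barycentric subdivision $\mathrm{Sd}(K)$ dual to the cocycle $d\epsilon$: its simplices are the faces of the simplices $[\hat\sigma_0,\dots,\hat\sigma_i]$, where $\sigma_0<\dots<\sigma_i$ are simplices of $K$, each a proper face of the next, $\hat\sigma_j$ is the barycenter of $\sigma_j$, $\dim\sigma_0=1$ and $\langle d\epsilon,\sigma_0\rangle\neq 0$ (that is, the two vertices of $\sigma_0$ have different labels). (1) Let $\sigma$ be a simplex of $K$ with $V_\epsilon\cap\sigma\neq\emptyset$. Then there is an affine hyperplane that strictly separates the vertices of $\sigma$ labelled $1$ from those labelled $0$; and for every such hyperplane, with section $H_\sigma\subset\sigma$, the set $V_\epsilon\cap\sigma$ is isotopic to $H_\sigma$ within $\sigma$: there is a continuous family of homeomorphisms $(h_t)_{t\in[0,1]}$ of $\sigma$ with $h_0=\mathrm{id}$ and $h_1(V_\epsilon\cap\sigma)=H_\sigma$.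 (2) $V_\epsilon\subset |K|$ has the structure of a CW complex whose $p$-cells, for every $p\ge 0$, are in bijection with the $(p+1)$-simplices $\sigma$ of $K$ on which $\epsilon$ is not constant, the closed cell corresponding to $\sigma$ being $V_\epsilon\cap\sigma$. -/

import Mathlib

universe u

namespace Geometry.SimplicialComplex

variable {E : Type u} [AddCommGroup E] [Module ℝ E]

/-- Every vertex belongs to only finitely many simplices. -/
def IsLocallyFinite (K : SimplicialComplex ℝ E) : Prop :=
  ∀ v ∈ K.vertices, {σ ∈ K.faces | v ∈ σ}.Finite

/-- The `p`-simplices of `K`, each given by its set of `p + 1` vertices. -/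
abbrev Simplices (K : SimplicialComplex ℝ E) (p : ℕ) : Type u :=
  {σ : Finset E // σ ∈ K.faces ∧ σ.card = p + 1}

/-- Simplicial `p`-cochains with coefficients in `ℤ/2ℤ`. -/
abbrev Cochain (K : SimplicialComplex ℝ E) (p : ℕ) : Type u :=
  K.Simplices p → ZMod 2

open Classical in
/-- The facet of a `(p + 1)`-simplex opposite to one of its vertices. -/
noncomputable def facetOpposite (K : SimplicialComplex ℝ E) {p : ℕ} (σ : K.Simplices (p + 1))
    (v : {v : E // v ∈ σ.1}) : K.Simplices p :=
  ⟨σ.1.erase v.1, by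
    have hc : (σ.1.erase v.1).card = p + 1 := by
      rw [Finset.card_erase_of_mem v.2, σ.2.2]
      rfl
    exact ⟨K.down_closed σ.2.1 (Finset.erase_subset _ _)
      (Finset.card_pos.mp (by rw [hc]; exact Nat.succ_pos p)), hc⟩⟩

/-- The coboundary operator: the value on `σ` is the sum of the values on the facets of `σ`. -/
noncomputable def coboundary (K : SimplicialComplex ℝ E) {p : ℕ} (ε : K.Cochain p) : K.Cochain (p + 1) :=
  fun σ => ∑ v : {v : E // v ∈ σ.1}, ε (K.facetOpposite σ v)

/-- The barycenter of the simplex with vertex set `σ`. -/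
noncomputable def barycenter (σ : Finset E) : E :=
  σ.centroid ℝ id

/-- A flag of simplices of `K`, that is, a finite set of simplices which is totally ordered by
the face relation. The barycenters of the members of a nonempty flag are the vertices of a simplex
of the barycentric subdivision of `K`. -/
def IsFlag (K : SimplicialComplex ℝ E) (c : Finset (Finset E)) : Prop :=
  (c : Set (Finset E)) ⊆ K.faces ∧ IsChain (· ⊆ ·) (c : Set (Finset E))

open Classical in
/-- The vertex set of the simplex `[σ̂₀, …, σ̂ᵢ]` of the barycentric subdivision that is given by a
flag `σ₀ < ⋯ < σᵢ`. -/
noncomputable def flagSimplex (c : Finset (Finset E)) : Finset E :=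
  c.image barycenter

/-- The simplices of the subcomplex `V_ε` of the barycentric subdivision: the faces of those
simplices `[σ̂₀, …, σ̂ᵢ]`, with `σ₀ < ⋯ < σᵢ`, for which `σ₀` has dimension `p + 1` and
`⟨dε, σ₀⟩ ≠ 0`. -/
def dualSimplices (K : SimplicialComplex ℝ E) {p : ℕ} (ε : K.Cochain p) : Set (Finset E) :=
  {s | s.Nonempty ∧ ∃ c : Finset (Finset E), K.IsFlag c ∧
    (∃ σ₀ : K.Simplices (p + 1), σ₀.1 ∈ c ∧ (∀ τ ∈ c, σ₀.1 ⊆ τ) ∧ K.coboundary ε σ₀ ≠ 0) ∧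
    s ⊆ flagSimplex c}

/-- The set of points of `V_ε`, the union of its simplices. -/
def dualSpace (K : SimplicialComplex ℝ E) {p : ℕ} (ε : K.Cochain p) : Set E :=
  ⋃ s ∈ K.dualSimplices ε, convexHull ℝ (s : Set E)

/-- The labelling `ε` of the vertices is constant on the vertices of `σ`. -/
def IsConstOn (K : SimplicialComplex ℝ E) (ε : K.Cochain 0) (σ : Finset E) : Prop :=
  ∀ a b : K.Simplices 0, a.1 ⊆ σ → b.1 ⊆ σ → ε a = ε b

/-- The affine hyperplane `{f = 0}` (strictly) separates the vertices of `σ` labelled `1` from the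
vertices of `σ` labelled `0`. -/
def Separates (K : SimplicialComplex ℝ E) (ε : K.Cochain 0) (σ : Finset E) (f : E →ᵃ[ℝ] ℝ) :
    Prop :=
  ∀ (a : K.Simplices 0), ∀ v ∈ a.1, v ∈ σ → (ε a = 1 → 0 < f v) ∧ (ε a = 0 → f v < 0)

/-- The polyhedron `|K|` of `K`. Its topology is the coherent one, see below, which may be finer
than the one induced by `E`. -/
def Polyhedron (K : SimplicialComplex ℝ E) : Type u :=
  {x : E // x ∈ K.space}

/-- `V_ε` as a subset of the polyhedron of `K`. -/
def dualSubset (K : SimplicialComplex ℝ E) {p : ℕ} (ε : K.Cochain p) : Set K.Polyhedron :=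
  {x | x.1 ∈ K.dualSpace ε}

/-- The closed simplex with vertex set `σ` as a subset of the polyhedron of `K`. -/
def closedSimplex (K : SimplicialComplex ℝ E) (σ : Finset E) : Set K.Polyhedron :=
  {x | x.1 ∈ convexHull ℝ (σ : Set E)}

/-- The inclusion of a closed simplex into the polyhedron. -/
def simplexInclusion (K : SimplicialComplex ℝ E) (σ : K.faces)
    (x : convexHull ℝ (σ.1 : Set E)) : K.Polyhedron :=
  ⟨x.1, K.convexHull_subset_space σ.2 x.2⟩

variable [TopologicalSpace E]

/-- The coherent topology: a subset is closed if and only if its intersection with every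
closed simplex is closed in that simplex. -/
instance (K : SimplicialComplex ℝ E) : TopologicalSpace K.Polyhedron :=
  ⨆ σ : K.faces, TopologicalSpace.coinduced (K.simplexInclusion σ) inferInstance

theorem isClosed_polyhedron_iff (K : SimplicialComplex ℝ E) (A : Set K.Polyhedron) :
    IsClosed A ↔ ∀ σ : K.faces, IsClosed (K.simplexInclusion σ ⁻¹' A) := by
  rw [isClosed_iSup_iff]
  exact forall_congr' fun σ => isClosed_coinduced

theorem continuous_polyhedron_val (K : SimplicialComplex ℝ E) :
    Continuous (fun x : K.Polyhedron => x.1) := by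
  rw [continuous_iSup_dom]
  intro σ
  rw [continuous_coinduced_dom]
  exact continuous_subtype_val

instance [T2Space E] (K : SimplicialComplex ℝ E) : T2Space K.Polyhedron :=
  T2Space.of_injective_continuous Subtype.val_injective K.continuous_polyhedron_val

end Geometry.SimplicialComplex

/-- `A` is isotopic to `B` within `X`: there is a continuous family of homeomorphisms of `X`, from
the identity to a homeomorphism that maps `A` onto `B`. -/
def IsotopicWithin {X : Type u} [TopologicalSpace X] (A B : Set X) : Prop :=
  ∃ h : unitInterval → (X ≃ₜ X), Continuous (fun q : unitInterval × X => h q.1 q.2) ∧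
    h 0 = Homeomorph.refl X ∧ h 1 '' A = B

/-!
A point of a simplex `σ` lies in `V_ε` if and only if the largest of its barycentric coordinates is
attained at vertices of both labels. It lies on a separating hyperplane `f = 0` if and only if the
coordinates at the vertices of either label have the same sum when weighted by `|f|`. Scaling the
coordinates at the vertices of each label by the ratio of their maximum to their weighted sum, and
then normalising, turns the first condition into the second. These ratios do not change when the
coordinates of one label are scaled, so reciprocal factors invert the map, and linear interpolation
of the factors from `1` gives the isotopy.

The section of a `(p + 1)`-simplex by a separating hyperplane is a compact convex set of dimension
`p`, hence a ball, whose interior consists of the points with positive coordinates. The isotopy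
preserves the faces of the simplex, so pulling this ball back to `V_ε` gives a cell whose boundary
lies in proper faces. The coherent topology of the polyhedron makes `V_ε` closed and gives it the
weak topology of its cells.
-/

namespace CocycleDual

open Set Filter Topology

section StdSimplex

variable {ι : Type*}

/-- The indices at which `f` has the same sign as at `i`, where `0` counts as negative. -/
def sameSide (f : ι → ℝ) (i : ι) : Set ι :=
  {j | 0 < f j ↔ 0 < f i}

theorem indicator_sameSide_nonneg {f w : ι → ℝ} (hw : 0 ≤ w) (i : ι) :
    0 ≤ (sameSide f i).indicator w :=
  indicator_nonneg fun j _ => hw j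

theorem sameSide_of_pos {f : ι → ℝ} {i : ι} (hi : 0 < f i) : sameSide f i = {j | 0 < f j} := by
  simp [sameSide, hi]

theorem sameSide_of_not_pos {f : ι → ℝ} {i : ι} (hi : ¬0 < f i) :
    sameSide f i = {j | 0 < f j}ᶜ := by
  simp [sameSide, hi, compl_def]

variable [Fintype ι]

/-- The projective action of positive weights `κ` on the standard simplex: multiply the `i`-th
coordinate by `κ i`, then normalise the sum of the coordinates. -/
noncomputable def reweight (κ w : ι → ℝ) : ι → ℝ :=
  fun i => κ i * w i / ∑ j, κ j * w j

/-- The factor by which a nonnegative vector `y` has to be scaled for its weighted coordinate sum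
`∑ i, F i * y i` to become its largest coordinate; at `y = 0`, where every factor does, it is `1`
in order to be positive. -/
noncomputable def normRatio (F y : ι → ℝ) : ℝ :=
  open Classical in if y = 0 then 1 else ‖y‖ / ∑ i, F i * y i

/-- The weights of the isotopy at time `t`. They interpolate linearly between `1` and the weights
after which `f` has mean `0` exactly for those `w` that have a largest coordinate on either side of
`f`. They are constant along the sides of `f` and invariant under weights of that kind, which makes
the time `t` map invertible. -/
noncomputable def balanceWeight (f : ι → ℝ) (t : ℝ) (w : ι → ℝ) (i : ι) : ℝ :=
  1 - t + t * normRatio (fun j => |f j|) ((sameSide f i).indicator w)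

section NormRatio

variable {F y : ι → ℝ}

theorem sum_mul_pos (hF : ∀ i, 0 < F i) (hy : 0 ≤ y) (hy0 : y ≠ 0) : 0 < ∑ i, F i * y i := by
  obtain ⟨i, hi⟩ := Function.ne_iff.1 hy0
  exact Finset.sum_pos' (fun j _ => mul_nonneg (hF j).le (hy j))
    ⟨i, Finset.mem_univ i, mul_pos (hF i) ((hy i).lt_of_ne' hi)⟩

theorem normRatio_of_ne_zero (hy0 : y ≠ 0) : normRatio F y = ‖y‖ / ∑ i, F i * y i :=
  if_neg hy0

theorem normRatio_pos (hF : ∀ i, 0 < F i) (hy : 0 ≤ y) : 0 < normRatio F y := by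
  unfold normRatio
  split_ifs with h
  · exact one_pos
  · exact div_pos (norm_pos_iff.2 h) (sum_mul_pos hF hy h)

theorem normRatio_smul {c : ℝ} (hc : 0 < c) : normRatio F (c • y) = normRatio F y := by
  unfold normRatio
  simp only [smul_eq_zero, hc.ne', false_or, Pi.smul_apply, smul_eq_mul, mul_left_comm _ c,
    ← Finset.mul_sum, norm_smul, Real.norm_of_nonneg hc.le, mul_div_mul_left _ _ hc.ne']

theorem normRatio_mul_sum (hF : ∀ i, 0 < F i) (hy : 0 ≤ y) :
    normRatio F y * ∑ i, F i * y i = ‖y‖ := by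
  rcases eq_or_ne y 0 with rfl | hy0
  · simp
  · rw [normRatio_of_ne_zero hy0, div_mul_cancel₀ _ (sum_mul_pos hF hy hy0).ne']

theorem normRatio_mul_apply_le (hF : ∀ i, 0 < F i) (hy : 0 ≤ y) (i : ι) :
    normRatio F y * y i ≤ ‖y‖ / F i := by
  rw [le_div_iff₀ (hF i), mul_assoc, mul_comm (y i), ← normRatio_mul_sum hF hy]
  have hle : F i * y i ≤ ∑ j, F j * y j :=
    Finset.single_le_sum (fun j _ => mul_nonneg (hF j).le (hy j)) (Finset.mem_univ i)
  exact mul_le_mul_of_nonneg_left hle (normRatio_pos hF hy).le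

/-- `normRatio F` itself is discontinuous at `0`, but it is bounded. -/
theorem continuousOn_normRatio_mul_apply (hF : ∀ i, 0 < F i) (i : ι) :
    ContinuousOn (fun y => normRatio F y * y i) (Ici 0) := by
  intro y hy
  rcases eq_or_ne y 0 with rfl | hy0
  · have hlim : Tendsto (fun z : ι → ℝ => ‖z‖ / F i) (𝓝[Ici 0] 0) (𝓝 0) := by
      have hcont : Continuous fun z : ι → ℝ => ‖z‖ / F i := by fun_prop
      simpa using hcont.continuousWithinAt.tendsto (x := 0) (s := Ici 0)
    simp only [ContinuousWithinAt, Pi.zero_apply, mul_zero]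
    refine squeeze_zero' ?_ ?_ hlim
    · filter_upwards [self_mem_nhdsWithin] with z hz
      exact mul_nonneg (normRatio_pos hF hz).le (hz i)
    · filter_upwards [self_mem_nhdsWithin] with z hz
      exact normRatio_mul_apply_le hF hz i
  · have hcont : ContinuousAt (fun z : ι → ℝ => ‖z‖ / (∑ j, F j * z j) * z i) y := by
      have hsum : Continuous fun z : ι → ℝ => ∑ j, F j * z j :=
        continuous_finsetSum _ fun j _ => by fun_prop
      exact (continuous_norm.continuousAt.div hsum.continuousAt (sum_mul_pos hF hy hy0).ne').mul
        (continuous_apply i).continuousAt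
    refine (hcont.congr ?_).continuousWithinAt
    filter_upwards [isOpen_ne.mem_nhds hy0] with z hz
    rw [normRatio_of_ne_zero hz]

end NormRatio

section Reweight

variable {κ w : ι → ℝ}

theorem ne_zero_of_mem_stdSimplex (hw : w ∈ stdSimplex ℝ ι) : w ≠ 0 := by
  rintro rfl
  exact zero_ne_one (Finset.sum_const_zero.symm.trans hw.2)

theorem sum_mul_pos_of_mem_stdSimplex (hκ : ∀ i, 0 < κ i) (hw : w ∈ stdSimplex ℝ ι) :
    0 < ∑ j, κ j * w j :=
  sum_mul_pos hκ hw.1 (ne_zero_of_mem_stdSimplex hw)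

theorem reweight_mem_stdSimplex (hκ : ∀ i, 0 < κ i) (hw : w ∈ stdSimplex ℝ ι) :
    reweight κ w ∈ stdSimplex ℝ ι := by
  have hsum := sum_mul_pos_of_mem_stdSimplex hκ hw
  refine ⟨fun i => div_nonneg (mul_nonneg (hκ i).le (hw.1 i)) hsum.le, ?_⟩
  simp only [reweight, ← Finset.sum_div, div_self hsum.ne']

theorem reweight_apply_pos_iff (hκ : ∀ i, 0 < κ i) (hw : w ∈ stdSimplex ℝ ι) (i : ι) :
    0 < reweight κ w i ↔ 0 < w i := by
  rw [reweight, div_pos_iff_of_pos_right (sum_mul_pos_of_mem_stdSimplex hκ hw),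
    mul_pos_iff_of_pos_left (hκ i)]

theorem reweight_one (hw : w ∈ stdSimplex ℝ ι) : reweight 1 w = w := by
  funext i
  simp [reweight, hw.2]

theorem reweight_inv_reweight (hκ : ∀ i, 0 < κ i) (hw : w ∈ stdSimplex ℝ ι) :
    reweight κ⁻¹ (reweight κ w) = w := by
  have hsum := sum_mul_pos_of_mem_stdSimplex hκ hw
  have hcancel (i : ι) : κ⁻¹ i * reweight κ w i = w i / ∑ j, κ j * w j := by
    rw [reweight, Pi.inv_apply, mul_div_assoc, inv_mul_cancel_left₀ (hκ i).ne']
  funext i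
  rw [reweight]
  simp only [hcancel, ← Finset.sum_div, hw.2]
  field_simp

end Reweight

section BalanceWeight

variable {f : ι → ℝ}

theorem balanceWeight_zero (w : ι → ℝ) : balanceWeight f 0 w = 1 := by
  funext i
  simp [balanceWeight]

theorem balanceWeight_pos (hf : ∀ i, f i ≠ 0) {t : ℝ} (ht : t ∈ Icc (0 : ℝ) 1) {w : ι → ℝ}
    (hw : 0 ≤ w) (i : ι) : 0 < balanceWeight f t w i := by
  have hpos : 0 < normRatio (fun j => |f j|) ((sameSide f i).indicator w) :=
    normRatio_pos (fun j => abs_pos.2 (hf j)) (indicator_sameSide_nonneg hw i)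
  unfold balanceWeight
  rcases ht.1.eq_or_lt with rfl | h0
  · simp
  · linarith [mul_pos h0 hpos, ht.2]

theorem balanceWeight_eq_of_mem_sameSide (t : ℝ) (w : ι → ℝ) {i j : ι} (hj : j ∈ sameSide f i) :
    balanceWeight f t w j = balanceWeight f t w i := by
  have hside : sameSide f j = sameSide f i := by
    simp only [sameSide, show 0 < f j ↔ 0 < f i from hj]
  simp only [balanceWeight, hside]

theorem balanceWeight_reweight {κ w : ι → ℝ} (hκ : ∀ i, 0 < κ i)
    (hside : ∀ i, ∀ j ∈ sameSide f i, κ j = κ i) (hw : w ∈ stdSimplex ℝ ι) (t : ℝ) :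
    balanceWeight f t (reweight κ w) = balanceWeight f t w := by
  funext i
  have hscale : (sameSide f i).indicator (reweight κ w) =
      (κ i / ∑ j, κ j * w j) • (sameSide f i).indicator w := by
    funext j
    by_cases hj : j ∈ sameSide f i
    · simp only [indicator_of_mem hj, Pi.smul_apply, smul_eq_mul, reweight, hside i j hj]
      ring
    · simp [indicator_of_notMem hj]
  rw [balanceWeight, hscale,
    normRatio_smul (div_pos (hκ i) (sum_mul_pos_of_mem_stdSimplex hκ hw)), balanceWeight]

theorem continuous_balanceWeight_mul_apply (hf : ∀ i, f i ≠ 0) (i : ι) :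
    Continuous fun q : unitInterval × stdSimplex ℝ ι =>
      balanceWeight f q.1 q.2.1 i * q.2.1 i := by
  have hcoord (j : ι) : Continuous fun q : unitInterval × stdSimplex ℝ ι => q.2.1 j :=
    (continuous_apply j).comp (continuous_subtype_val.comp continuous_snd)
  have htime : Continuous fun q : unitInterval × stdSimplex ℝ ι => (q.1 : ℝ) :=
    continuous_subtype_val.comp continuous_fst
  have hside : Continuous fun q : unitInterval × stdSimplex ℝ ι =>
      (sameSide f i).indicator q.2.1 := by
    refine continuous_pi fun j => ?_
    by_cases hj : j ∈ sameSide f i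
    · simpa only [indicator_of_mem hj] using hcoord j
    · simpa only [indicator_of_notMem hj] using continuous_const
  have hratio : Continuous fun q : unitInterval × stdSimplex ℝ ι =>
      normRatio (fun j => |f j|) ((sameSide f i).indicator q.2.1) * q.2.1 i := by
    have hcomp := (continuousOn_normRatio_mul_apply (fun j => abs_pos.2 (hf j)) i).comp_continuous
      hside fun q => indicator_sameSide_nonneg q.2.2.1 i
    simpa only [Function.comp_def, indicator_of_mem (show i ∈ sameSide f i from Iff.rfl)]
      using hcomp
  simp only [balanceWeight, add_mul, mul_assoc]
  exact ((continuous_const.sub htime).mul (hcoord i)).add (htime.mul hratio)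

theorem sum_mul_balanceWeight_one (hf : ∀ i, f i ≠ 0) {w : ι → ℝ} (hw : 0 ≤ w) :
    ∑ i, f i * (balanceWeight f 1 w i * w i) =
      ‖{i | 0 < f i}.indicator w‖ - ‖{i | 0 < f i}ᶜ.indicator w‖ := by
  have hnorm (s : Set ι) := normRatio_mul_sum (F := fun j => |f j|) (y := s.indicator w)
    (fun j => abs_pos.2 (hf j)) (indicator_nonneg fun j _ => hw j)
  rw [← hnorm, ← hnorm, Finset.mul_sum, Finset.mul_sum, ← Finset.sum_sub_distrib]
  refine Finset.sum_congr rfl fun i _ => ?_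
  by_cases hi : 0 < f i
  · simp only [balanceWeight, sameSide_of_pos hi, indicator_of_mem (show i ∈ {j | 0 < f j} from hi),
      indicator_of_notMem (show i ∉ {j | 0 < f j}ᶜ from not_not.2 hi), abs_of_pos hi]
    ring
  · simp only [balanceWeight, sameSide_of_not_pos hi,
      indicator_of_notMem (show i ∉ {j | 0 < f j} from hi),
      indicator_of_mem (show i ∈ {j | 0 < f j}ᶜ from hi), abs_of_nonpos (not_lt.1 hi)]
    ring

end BalanceWeight

section NormIndicator

variable {w : ι → ℝ}

theorem norm_indicator_eq_norm_iff (hw : 0 ≤ w) (hw0 : w ≠ 0) (s : Set ι) :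
    ‖s.indicator w‖ = ‖w‖ ↔ ∃ a ∈ s, ∀ i, w i ≤ w a := by
  have hle (i : ι) : w i ≤ ‖w‖ := (le_abs_self _).trans (norm_le_pi_norm w i)
  have hind_le : ‖s.indicator w‖ ≤ ‖w‖ :=
    (pi_norm_le_iff_of_nonneg (norm_nonneg w)).2 fun i =>
      (norm_indicator_le_norm_self w i).trans (norm_le_pi_norm w i)
  constructor
  · intro h
    have : Nonempty ι := ⟨(Function.ne_iff.1 hw0).choose⟩
    obtain ⟨a, ha⟩ := Finite.exists_max (s.indicator w)
    have hmax : ‖w‖ ≤ s.indicator w a := by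
      have hnn (i : ι) : 0 ≤ s.indicator w i := indicator_nonneg (fun j _ => hw j) i
      rw [← h, pi_norm_le_iff_of_nonneg (hnn a)]
      exact fun i => (Real.norm_of_nonneg (hnn i)).trans_le (ha i)
    have has : a ∈ s := mem_of_indicator_ne_zero ((norm_pos_iff.2 hw0).trans_le hmax).ne'
    rw [indicator_of_mem has] at hmax
    exact ⟨a, has, fun i => (hle i).trans hmax⟩
  · rintro ⟨a, has, hmax⟩
    refine hind_le.antisymm ((pi_norm_le_iff_of_nonneg (norm_nonneg _)).2 fun i => ?_)
    calc ‖w i‖ = w i := Real.norm_of_nonneg (hw i)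
      _ ≤ s.indicator w a := (hmax i).trans_eq (indicator_of_mem has w).symm
      _ ≤ ‖s.indicator w‖ := (le_abs_self _).trans (norm_le_pi_norm (s.indicator w) a)

theorem norm_indicator_eq_norm_indicator_compl_iff (hw : 0 ≤ w) (hw0 : w ≠ 0) (s : Set ι) :
    ‖s.indicator w‖ = ‖sᶜ.indicator w‖ ↔
      (∃ a ∈ s, ∀ i, w i ≤ w a) ∧ ∃ b ∈ sᶜ, ∀ i, w i ≤ w b := by
  rw [← norm_indicator_eq_norm_iff hw hw0, ← norm_indicator_eq_norm_iff hw hw0]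
  have : Nonempty ι := ⟨(Function.ne_iff.1 hw0).choose⟩
  obtain ⟨a, ha⟩ := Finite.exists_max w
  have hor : ‖s.indicator w‖ = ‖w‖ ∨ ‖sᶜ.indicator w‖ = ‖w‖ :=
    (em (a ∈ s)).imp (fun h => (norm_indicator_eq_norm_iff hw hw0 s).2 ⟨a, h, ha⟩)
      fun h => (norm_indicator_eq_norm_iff hw hw0 sᶜ).2 ⟨a, h, ha⟩
  grind

end NormIndicator

section Balance

variable {f : ι → ℝ} (hf : ∀ i, f i ≠ 0)

/-- The time `t` map of the isotopy, as a bijection of the standard simplex. -/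
noncomputable def balanceEquiv (t : unitInterval) : stdSimplex ℝ ι ≃ stdSimplex ℝ ι where
  toFun w := ⟨reweight (balanceWeight f t w.1) w.1,
    reweight_mem_stdSimplex (balanceWeight_pos hf t.2 w.2.1) w.2⟩
  invFun w := ⟨reweight (balanceWeight f t w.1)⁻¹ w.1,
    reweight_mem_stdSimplex (fun i => inv_pos.2 (balanceWeight_pos hf t.2 w.2.1 i)) w.2⟩
  left_inv w := by
    have hpos := balanceWeight_pos hf t.2 w.2.1
    refine Subtype.ext ?_
    dsimp only
    rw [balanceWeight_reweight hpos (fun _ _ => balanceWeight_eq_of_mem_sameSide _ _) w.2,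
      reweight_inv_reweight hpos w.2]
  right_inv w := by
    have hpos : ∀ i, 0 < (balanceWeight f t w.1)⁻¹ i :=
      fun i => inv_pos.2 (balanceWeight_pos hf t.2 w.2.1 i)
    refine Subtype.ext ?_
    dsimp only
    rw [balanceWeight_reweight hpos
      (fun _ _ hj => congrArg Inv.inv (balanceWeight_eq_of_mem_sameSide _ _ hj)) w.2]
    simpa only [inv_inv] using reweight_inv_reweight hpos w.2

theorem continuous_balanceEquiv :
    Continuous fun q : unitInterval × stdSimplex ℝ ι => balanceEquiv hf q.1 q.2 := by
  refine Continuous.subtype_mk (continuous_pi fun i => ?_) _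
  exact (continuous_balanceWeight_mul_apply hf i).div
    (continuous_finsetSum _ fun j _ => continuous_balanceWeight_mul_apply hf j)
    fun q => (sum_mul_pos_of_mem_stdSimplex (balanceWeight_pos hf q.1.2 q.2.2.1) q.2.2).ne'

/-- The time `t` map of the isotopy, as a homeomorphism of the standard simplex. -/
noncomputable def balanceHomeo (t : unitInterval) : stdSimplex ℝ ι ≃ₜ stdSimplex ℝ ι :=
  Continuous.homeoOfEquivCompactToT2 (f := balanceEquiv hf t)
    ((continuous_balanceEquiv hf).comp (continuous_const.prodMk continuous_id))

theorem continuous_balanceHomeo :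
    Continuous fun q : unitInterval × stdSimplex ℝ ι => balanceHomeo hf q.1 q.2 :=
  continuous_balanceEquiv hf

theorem coe_balanceHomeo (t : unitInterval) (w : stdSimplex ℝ ι) :
    (balanceHomeo hf t w).1 = reweight (balanceWeight f t w.1) w.1 :=
  rfl

theorem balanceHomeo_zero : balanceHomeo hf 0 = Homeomorph.refl _ := by
  refine Homeomorph.ext fun w => Subtype.ext ?_
  rw [coe_balanceHomeo, Icc.coe_zero, balanceWeight_zero, reweight_one w.2, Homeomorph.refl_apply,
    id]

theorem balanceHomeo_apply_pos_iff (t : unitInterval) (w : stdSimplex ℝ ι) (i : ι) :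
    0 < (balanceHomeo hf t w).1 i ↔ 0 < w.1 i :=
  reweight_apply_pos_iff (balanceWeight_pos hf t.2 w.2.1) w.2 i

theorem sum_mul_balanceHomeo_one_eq_zero_iff (w : stdSimplex ℝ ι) :
    ∑ i, f i * (balanceHomeo hf 1 w).1 i = 0 ↔
      (∃ a, 0 < f a ∧ ∀ i, w.1 i ≤ w.1 a) ∧ ∃ b, ¬0 < f b ∧ ∀ i, w.1 i ≤ w.1 b := by
  have hsum : 0 < ∑ j, balanceWeight f 1 w.1 j * w.1 j :=
    sum_mul_pos_of_mem_stdSimplex (balanceWeight_pos hf unitInterval.one_mem w.2.1) w.2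
  simp only [coe_balanceHomeo, Icc.coe_one, reweight, ← mul_div_assoc, ← Finset.sum_div]
  rw [div_eq_zero_iff, or_iff_left hsum.ne', sum_mul_balanceWeight_one hf w.2.1, sub_eq_zero]
  exact norm_indicator_eq_norm_indicator_compl_iff w.2.1 (ne_zero_of_mem_stdSimplex w.2) _

end Balance

end StdSimplex

section HyperplaneSection

theorem exists_homeomorph_image_ball_eq {V : Type*} [NormedAddCommGroup V] [NormedSpace ℝ V]
    [FiniteDimensional ℝ V] {s : Set V} (hconv : Convex ℝ s) (hopen : IsOpen s)
    (hne : s.Nonempty) (hbdd : Bornology.IsBounded s) :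
    ∃ h : (Fin (Module.finrank ℝ V) → ℝ) ≃ₜ V,
      h '' Metric.ball 0 1 = s ∧ h '' Metric.closedBall 0 1 = closure s := by
  let e : (Fin (Module.finrank ℝ V) → ℝ) ≃L[ℝ] V := ContinuousLinearEquiv.ofFinrankEq (by simp)
  have hconv' : Convex ℝ (e ⁻¹' s) := hconv.linear_preimage e.toLinearMap
  have hint : interior (e ⁻¹' s) = e ⁻¹' s := (hopen.preimage e.continuous).interior_eq
  obtain ⟨h, hball, hclosedBall, -⟩ := exists_homeomorph_image_interior_closure_frontier_eq_unitBall
    hconv' (hint.symm ▸ hne.preimage e.surjective) (e.antilipschitz.isBounded_preimage hbdd)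
  rw [hint] at hball
  refine ⟨h.symm.trans e.toHomeomorph, ?_, ?_⟩
  · rw [← hball, ← image_comp]
    simpa [Function.comp_def] using image_preimage_eq s e.surjective
  · rw [← hclosedBall, ← image_comp]
    simpa [Function.comp_def, image_preimage_eq _ e.surjective] using
      (e.toHomeomorph.image_closure (e ⁻¹' s))

variable {ι : Type*}

section PositiveTranslates

variable {V : Submodule ℝ (ι → ℝ)} {c : ι → ℝ}

theorem convex_setOf_forall_pos_add : Convex ℝ {u : V | ∀ i, 0 < c i + u.1 i} := by
  have heq : {u : V | ∀ i, 0 < c i + u.1 i} = ⋂ i, V.subtype ⁻¹' {u | -c i < u i} := by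
    ext u
    simp [neg_lt_iff_pos_add']
  rw [heq]
  exact convex_iInter fun i => (convex_halfSpace_gt (LinearMap.proj i).isLinear _).linear_preimage _

theorem isOpen_setOf_forall_pos_add [Finite ι] : IsOpen {u : V | ∀ i, 0 < c i + u.1 i} := by
  simp only [ofPred_forall]
  exact isOpen_iInter_of_finite fun i => isOpen_lt continuous_const <|
    continuous_const.add ((continuous_apply i).comp continuous_subtype_val)

theorem closure_setOf_forall_pos_add (hc : ∀ i, 0 < c i) :
    closure {u : V | ∀ i, 0 < c i + u.1 i} = {u : V | ∀ i, 0 ≤ c i + u.1 i} := by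
  refine Subset.antisymm (closure_minimal (fun u hu i => (hu i).le) ?_) fun u hu => ?_
  · simp only [ofPred_forall]
    exact isClosed_iInter fun i => isClosed_le continuous_const <|
      continuous_const.add ((continuous_apply i).comp continuous_subtype_val)
  · refine closure_mono ?_ (segment_subset_closure_openSegment (right_mem_segment ℝ (0 : V) u))
    rintro _ ⟨a, b, ha, hb, hab, rfl⟩ i
    calc 0 < a * c i + b * (c i + u.1 i) :=
          add_pos_of_pos_of_nonneg (mul_pos ha (hc i)) (mul_nonneg hb.le (hu i))
      _ = (a + b) * c i + b * u.1 i := by ring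
      _ = c i + (a • (0 : V) + b • u).1 i := by simp [hab]

end PositiveTranslates

variable [Fintype ι]

/-- The directions parallel to the section of the standard simplex by the hyperplane
`∑ i, f i * w i = 0`. -/
noncomputable def sectionDirection (f : ι → ℝ) : Submodule ℝ (ι → ℝ) :=
  LinearMap.ker (Fintype.linearCombination ℝ fun i => ((1 : ℝ), f i))

variable {f : ι → ℝ}

theorem mem_sectionDirection_iff {u : ι → ℝ} :
    u ∈ sectionDirection f ↔ ∑ i, u i = 0 ∧ ∑ i, f i * u i = 0 := by
  simp [sectionDirection, Fintype.linearCombination_apply, Prod.ext_iff, Prod.fst_sum,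
    Prod.snd_sum, mul_comm]

theorem finrank_sectionDirection_add_two {a b : ι} (hab : f a ≠ f b) :
    Module.finrank ℝ (sectionDirection f) + 2 = Fintype.card ι := by
  classical
  have hsurj : Function.Surjective (Fintype.linearCombination ℝ fun i => ((1 : ℝ), f i)) := by
    rintro ⟨x, y⟩
    refine ⟨Pi.single a ((y - f b * x) / (f a - f b)) + Pi.single b ((f a * x - y) / (f a - f b)),
      ?_⟩
    have := sub_ne_zero.2 hab
    rw [map_add, Fintype.linearCombination_apply_single, Fintype.linearCombination_apply_single]
    ext <;> simp <;> field_simp <;> ring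
  have hrank := LinearMap.finrank_range_add_finrank_ker
    (Fintype.linearCombination ℝ fun i => ((1 : ℝ), f i))
  rw [LinearMap.range_eq_top.2 hsurj, finrank_top, Module.finrank_prod, Module.finrank_self,
    Module.finrank_pi] at hrank
  rw [sectionDirection]
  omega

theorem add_mem_stdSimplex_iff {w u : ι → ℝ} (hw : w ∈ stdSimplex ℝ ι) (hu : ∑ i, u i = 0) :
    w + u ∈ stdSimplex ℝ ι ↔ ∀ i, 0 ≤ w i + u i := by
  simp [stdSimplex, Finset.sum_add_distrib, hw.2, hu]

theorem isBounded_setOf_forall_pos_add {w : ι → ℝ} (hw : w ∈ stdSimplex ℝ ι) :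
    Bornology.IsBounded {u : sectionDirection f | ∀ i, 0 < w i + u.1 i} := by
  have hisom : Isometry fun u : sectionDirection f => w + u.1 :=
    Isometry.of_dist_eq fun u v => dist_add_left w u.1 v.1
  refine (hisom.antilipschitz.isBounded_preimage (bounded_stdSimplex ι)).subset fun u hu => ?_
  exact (add_mem_stdSimplex_iff hw (mem_sectionDirection_iff.1 u.2).1).2 fun i => (hu i).le

theorem exists_pos_sum_mul_eq_zero (hf : ∀ i, f i ≠ 0) {a b : ι} (ha : 0 < f a) (hb : f b < 0) :
    ∃ w : stdSimplex ℝ ι, (∀ i, 0 < w.1 i) ∧ ∑ i, f i * w.1 i = 0 := by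
  have : Nonempty ι := ⟨a⟩
  refine ⟨balanceHomeo hf 1 stdSimplex.barycenter, fun i => ?_, ?_⟩
  · rw [balanceHomeo_apply_pos_iff]
    simpa using Fintype.card_pos
  · rw [sum_mul_balanceHomeo_one_eq_zero_iff]
    exact ⟨⟨a, ha, fun i => le_rfl⟩, b, hb.not_gt, fun i => le_rfl⟩

theorem exists_closedBall_parametrization (hf : ∀ i, f i ≠ 0) {a b : ι} (ha : 0 < f a)
    (hb : f b < 0) {p : ℕ} (hp : Fintype.card ι = p + 2) :
    ∃ g : Metric.closedBall (0 : Fin p → ℝ) 1 → stdSimplex ℝ ι,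
      Continuous g ∧ Function.Injective g ∧ range g = {w | ∑ i, f i * w.1 i = 0} ∧
      ∀ u, (∀ i, 0 < (g u).1 i) ↔ u.1 ∈ Metric.ball 0 1 := by
  obtain ⟨w, hpos, hsum⟩ := exists_pos_sum_mul_eq_zero hf ha hb
  obtain rfl : Module.finrank ℝ (sectionDirection f) = p := by
    have := finrank_sectionDirection_add_two (hb.trans ha).ne'
    omega
  obtain ⟨h, hball, hclosedBall⟩ := exists_homeomorph_image_ball_eq
    (s := {u : sectionDirection f | ∀ i, 0 < w.1 i + u.1 i}) convex_setOf_forall_pos_add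
    isOpen_setOf_forall_pos_add ⟨0, by simpa using hpos⟩ (isBounded_setOf_forall_pos_add w.2)
  rw [closure_setOf_forall_pos_add hpos] at hclosedBall
  have hmem {u : Fin _ → ℝ} (hu : u ∈ Metric.closedBall 0 1) :
      w.1 + (h u).1 ∈ stdSimplex ℝ ι :=
    (add_mem_stdSimplex_iff w.2 (mem_sectionDirection_iff.1 (h u).2).1).2
      (hclosedBall.subset (mem_image_of_mem h hu))
  refine ⟨fun u => ⟨w.1 + (h u).1, hmem u.2⟩, ?_, ?_, ?_, ?_⟩
  · exact (continuous_const.add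
      (continuous_subtype_val.comp (h.continuous.comp continuous_subtype_val))).subtype_mk _
  · intro u v huv
    exact Subtype.ext (h.injective (Subtype.ext (add_left_cancel (congrArg Subtype.val huv))))
  · refine Subset.antisymm ?_ fun x hx => ?_
    · rintro _ ⟨u, rfl⟩
      simp [mul_add, Finset.sum_add_distrib, hsum, (mem_sectionDirection_iff.1 (h u).2).2]
    · have hdir : x.1 - w.1 ∈ sectionDirection f := mem_sectionDirection_iff.2
        ⟨by simp [x.2.2, w.2.2], by simpa [mul_sub, hsum] using hx⟩
      obtain ⟨u, hu, hux⟩ : (⟨x.1 - w.1, hdir⟩ : sectionDirection f) ∈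
          h '' Metric.closedBall 0 1 := by
        rw [hclosedBall]
        simpa using x.2.1
      exact ⟨⟨u, hu⟩, Subtype.ext (by simp [hux])⟩
  · intro u
    rw [← h.injective.mem_set_image, hball]
    rfl

end HyperplaneSection

theorem exists_nonneg_sum_filter_le_eq {R : Finset ℝ} (hR : ∀ r ∈ R, 0 ≤ r) :
    ∃ l : ℝ → ℝ, (∀ r, 0 ≤ l r) ∧ ∀ x ∈ R, ∑ r ∈ R with r ≤ x, l r = x := by
  induction R using Finset.induction_on_max with
  | empty => exact ⟨0, fun _ => le_rfl, by simp⟩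
  | insert m R hm ih =>
    obtain ⟨l, hl, hsum⟩ := ih fun r hr => hR r (Finset.mem_insert_of_mem hr)
    have hmR : m ∉ R := fun h => (hm m h).false
    have htotal : ∑ r ∈ R, l r ≤ m := by
      rcases R.eq_empty_or_nonempty with rfl | hne
      · simpa using hR m (Finset.mem_insert_self m ∅)
      · have hmax := hsum _ (R.max'_mem hne)
        rw [Finset.filter_true_of_mem fun r hr => R.le_max' r hr] at hmax
        exact hmax.trans_le (hm _ (R.max'_mem hne)).le
    refine ⟨Function.update l m (m - ∑ r ∈ R, l r), fun r => ?_, fun x hx => ?_⟩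
    · rcases eq_or_ne r m with rfl | hr
      · simpa using htotal
      · simpa [hr] using hl r
    · have hupdate {S : Finset ℝ} (hS : S ⊆ R) :
          ∑ r ∈ S, Function.update l m (m - ∑ r ∈ R, l r) r = ∑ r ∈ S, l r :=
        Finset.sum_update_of_notMem (fun h => hmR (hS h)) _ _
      rcases Finset.mem_insert.1 hx with rfl | hx
      · rw [Finset.filter_true_of_mem (by
          simpa using fun r hr => (hm r hr).le), Finset.sum_insert hmR, hupdate subset_rfl]
        simp
      · rw [Finset.filter_insert, if_neg (hm x hx).not_ge, hupdate (Finset.filter_subset _ _),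
          hsum x hx]

section Superlevel

variable {α : Type*}

/-- The vertices of `σ` at which `w` is at least `r`. -/
noncomputable def superlevel (σ : Finset α) (w : α → ℝ) (r : ℝ) : Finset α :=
  {v ∈ σ | r ≤ w v}

theorem superlevel_subset (σ : Finset α) (w : α → ℝ) (r : ℝ) : superlevel σ w r ⊆ σ :=
  Finset.filter_subset _ _

theorem superlevel_antitone (σ : Finset α) (w : α → ℝ) : Antitone (superlevel σ w) :=
  fun _ _ hrs => Finset.monotone_filter_right _ fun _ _ hv => hrs.trans hv

theorem superlevel_nonempty {σ : Finset α} {w : α → ℝ} {r : ℝ} (hr : r ∈ σ.image w) :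
    (superlevel σ w r).Nonempty := by
  obtain ⟨v, hv, rfl⟩ := Finset.mem_image.1 hr
  exact ⟨v, Finset.mem_filter.2 ⟨hv, le_rfl⟩⟩

end Superlevel

section Barycentric

open Geometry SimplicialComplex

variable {E : Type*} [AddCommGroup E] [Module ℝ E]

/-- `w` is a family of barycentric coordinates of the point `x` of the simplex with vertex set `σ`,
extended by `0` to all of `E` so that coordinates in different simplices can be compared. -/
structure IsBarycentric (σ : Finset E) (w : E → ℝ) (x : E) : Prop where
  nonneg : ∀ v, 0 ≤ w v
  eq_zero : ∀ v ∉ σ, w v = 0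
  sum_eq_one : ∑ v ∈ σ, w v = 1
  sum_smul_eq : ∑ v ∈ σ, w v • v = x

variable {σ τ : Finset E} {w : E → ℝ} {x : E}

namespace IsBarycentric

theorem mono (h : IsBarycentric σ w x) (hστ : σ ⊆ τ) : IsBarycentric τ w x where
  nonneg := h.nonneg
  eq_zero v hv := h.eq_zero v fun hvσ => hv (hστ hvσ)
  sum_eq_one := by
    rw [← h.sum_eq_one, Finset.sum_subset hστ fun v _ => h.eq_zero v]
  sum_smul_eq := by
    rw [← h.sum_smul_eq, Finset.sum_subset hστ fun v _ hv => by rw [h.eq_zero v hv, zero_smul]]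

theorem restrict (h : IsBarycentric σ w x) (hτσ : τ ⊆ σ) (h0 : ∀ v ∈ σ, v ∉ τ → w v = 0) :
    IsBarycentric τ w x where
  nonneg := h.nonneg
  eq_zero v hv := (em (v ∈ σ)).elim (fun hvσ => h0 v hvσ hv) (h.eq_zero v)
  sum_eq_one := by
    rw [← h.sum_eq_one, Finset.sum_subset hτσ h0]
  sum_smul_eq := by
    rw [← h.sum_smul_eq, Finset.sum_subset hτσ fun v hv hvτ => by rw [h0 v hv hvτ, zero_smul]]

theorem smul_add_smul {w' : E → ℝ} {x' : E} (h : IsBarycentric σ w x) (h' : IsBarycentric σ w' x')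
    {s t : ℝ} (hs : 0 ≤ s) (ht : 0 ≤ t) (hst : s + t = 1) :
    IsBarycentric σ (s • w + t • w') (s • x + t • x') where
  nonneg v := add_nonneg (mul_nonneg hs (h.nonneg v)) (mul_nonneg ht (h'.nonneg v))
  eq_zero v hv := by simp [h.eq_zero v hv, h'.eq_zero v hv]
  sum_eq_one := by
    simp [Finset.sum_add_distrib, ← Finset.mul_sum, h.sum_eq_one, h'.sum_eq_one, hst]
  sum_smul_eq := by
    simp [add_smul, mul_smul, Finset.sum_add_distrib, ← Finset.smul_sum, h.sum_smul_eq,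
      h'.sum_smul_eq]

theorem mem_of_forall_le (h : IsBarycentric σ w x) {a : E} (ha : ∀ v, w v ≤ w a) : a ∈ σ := by
  by_contra haσ
  have hsum : ∑ v ∈ σ, w v ≤ 0 :=
    Finset.sum_nonpos fun v _ => (ha v).trans_eq (h.eq_zero a haσ)
  rw [h.sum_eq_one] at hsum
  exact absurd hsum one_pos.not_ge

theorem nonempty (h : IsBarycentric σ w x) : σ.Nonempty :=
  Finset.nonempty_of_sum_ne_zero (h.sum_eq_one.trans_ne one_ne_zero)

end IsBarycentric

theorem mem_convexHull_iff_exists_isBarycentric :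
    x ∈ convexHull ℝ (σ : Set E) ↔ ∃ w, IsBarycentric σ w x := by
  rw [Finset.mem_convexHull']
  constructor
  · rintro ⟨w, hw0, hw1, rfl⟩
    refine ⟨(σ : Set E).indicator w, indicator_nonneg hw0, fun v hv => indicator_of_notMem hv w,
      ?_, ?_⟩
    · rw [← hw1]
      exact Finset.sum_congr rfl fun v hv => indicator_of_mem (Finset.mem_coe.2 hv) w
    · exact Finset.sum_congr rfl fun v hv => by rw [indicator_of_mem (Finset.mem_coe.2 hv)]
  · rintro ⟨w, hw⟩
    exact ⟨w, fun v _ => hw.nonneg v, hw.sum_eq_one, hw.sum_smul_eq⟩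

theorem barycenter_eq_smul_sum (hσ : σ.Nonempty) :
    barycenter σ = (σ.card : ℝ)⁻¹ • ∑ v ∈ σ, v := by
  rw [barycenter, Finset.centroid_eq_centerMass _ hσ, Finset.centerMass_eq_of_sum_1 _ _
    (Finset.sum_centroidWeights_eq_one_of_nonempty ℝ σ hσ), Finset.smul_sum]
  simp

theorem isBarycentric_barycenter (hσ : σ.Nonempty) :
    IsBarycentric σ ((σ : Set E).indicator fun _ => (σ.card : ℝ)⁻¹) (barycenter σ) where
  nonneg v := indicator_nonneg (fun _ _ => by positivity) v
  eq_zero v hv := indicator_of_notMem hv _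
  sum_eq_one := by
    rw [Finset.sum_indicator_subset _ subset_rfl, Finset.sum_const, nsmul_eq_mul,
      mul_inv_cancel₀ (Nat.cast_ne_zero.2 hσ.card_pos.ne')]
  sum_smul_eq := by
    rw [barycenter_eq_smul_sum hσ, Finset.smul_sum]
    exact Finset.sum_congr rfl fun v hv => by rw [indicator_of_mem (Finset.mem_coe.2 hv)]

theorem exists_isBarycentric_of_mem_convexHull_flagSimplex {c : Finset (Finset E)}
    (hcσ : ∀ τ ∈ c, τ ⊆ σ) {ρ : Finset E} (hρ : ∀ τ ∈ c, ρ ⊆ τ) (hne : ρ.Nonempty)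
    (hx : x ∈ convexHull ℝ (flagSimplex c : Set E)) :
    ∃ w, IsBarycentric σ w x ∧ ∀ a ∈ ρ, ∀ v, w v ≤ w a := by
  classical
  refine convexHull_min (t := {x | ∃ w, IsBarycentric σ w x ∧ ∀ a ∈ ρ, ∀ v, w v ≤ w a}) ?_ ?_ hx
  · intro y hy
    obtain ⟨τ, hτ, rfl⟩ := Finset.mem_image.1 (Finset.mem_coe.1 hy)
    refine ⟨_, (isBarycentric_barycenter (hne.mono (hρ τ hτ))).mono (hcσ τ hτ), fun a ha v => ?_⟩
    rw [indicator_of_mem (Finset.mem_coe.2 (hρ τ hτ ha))]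
    exact indicator_le_self' (fun _ _ => by positivity) v
  · rintro _ ⟨w₁, h₁, hmax₁⟩ _ ⟨w₂, h₂, hmax₂⟩ s t hs ht hst
    exact ⟨_, h₁.smul_add_smul h₂ hs ht hst, fun a ha v => add_le_add
      (mul_le_mul_of_nonneg_left (hmax₁ a ha v) hs) (mul_le_mul_of_nonneg_left (hmax₂ a ha v) ht)⟩

open Classical in
/-- The layer cake decomposition of the coordinates into multiples of indicator functions of
superlevel sets writes `x` as a convex combination of their barycenters. -/
theorem IsBarycentric.mem_convexHull_flagSimplex_superlevel (h : IsBarycentric σ w x) :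
    x ∈ convexHull ℝ
      (flagSimplex ((σ.image w).image (superlevel σ w)) : Set E) := by
  obtain ⟨l, hl, hsum⟩ := exists_nonneg_sum_filter_le_eq (R := σ.image w)
    (Finset.forall_mem_image.2 fun v _ => h.nonneg v)
  have hlayer {v : E} (hv : v ∈ σ) : w v = ∑ r ∈ σ.image w, if r ≤ w v then l r else 0 := by
    rw [← Finset.sum_filter, hsum _ (Finset.mem_image_of_mem w hv)]
  have hcard {r : ℝ} (hr : r ∈ σ.image w) : ((superlevel σ w r).card : ℝ) ≠ 0 :=
    Nat.cast_ne_zero.2 (superlevel_nonempty hr).card_pos.ne'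
  have hone : ∑ r ∈ σ.image w, l r * (superlevel σ w r).card = 1 := by
    rw [← h.sum_eq_one, Finset.sum_congr rfl fun v hv => hlayer hv, Finset.sum_comm]
    refine Finset.sum_congr rfl fun r _ => ?_
    rw [← Finset.sum_filter, Finset.sum_const, nsmul_eq_mul, mul_comm, superlevel]
  have hx : x = ∑ r ∈ σ.image w,
      (l r * (superlevel σ w r).card) • barycenter (superlevel σ w r) := by
    rw [← h.sum_smul_eq, Finset.sum_congr rfl fun v hv => by rw [hlayer hv, Finset.sum_smul],
      Finset.sum_comm]
    refine Finset.sum_congr rfl fun r hr => ?_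
    rw [barycenter_eq_smul_sum (superlevel_nonempty hr), smul_smul,
      mul_inv_cancel_right₀ (hcard hr), superlevel, Finset.sum_filter, Finset.smul_sum]
    exact Finset.sum_congr rfl fun v _ => by rw [ite_smul, smul_ite, zero_smul, smul_zero]
  rw [hx]
  exact (convex_convexHull ℝ _).sum_mem (fun r _ => mul_nonneg (hl r) (Nat.cast_nonneg _)) hone
    fun r hr => subset_convexHull ℝ _ (Finset.mem_coe.2
      (Finset.mem_image_of_mem _ (Finset.mem_image_of_mem _ hr)))

end Barycentric

section Labels

open Geometry SimplicialComplex

variable {E : Type*} [AddCommGroup E] [Module ℝ E] (K : SimplicialComplex ℝ E)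

open Classical in
/-- The value of the cochain `ε` at the vertex `v`, with junk value `0` outside the vertex set. -/
noncomputable def label (ε : K.Cochain 0) (v : E) : ZMod 2 :=
  if h : {v} ∈ K.faces then ε ⟨{v}, h, rfl⟩ else 0

variable {K} {ε : K.Cochain 0} {σ τ : Finset E} {w : E → ℝ} {x : E}

theorem apply_eq_label (a : K.Simplices 0) {v : E} (hv : v ∈ a.1) : ε a = label K ε v := by
  obtain ⟨s, hs, hcard⟩ := a
  obtain ⟨u, rfl⟩ := Finset.card_eq_one.1 hcard
  obtain rfl := Finset.mem_singleton.1 hv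
  simp [label, hs]

theorem singleton_mem_faces (hσ : σ ∈ K.faces) {v : E} (hv : v ∈ σ) : {v} ∈ K.faces :=
  K.down_closed hσ (Finset.singleton_subset_iff.2 hv) (Finset.singleton_nonempty v)

theorem apply_singleton_eq_label {v : E} (h : {v} ∈ K.faces ∧ ({v} : Finset E).card = 0 + 1) :
    ε ⟨{v}, h⟩ = label K ε v :=
  apply_eq_label _ (Finset.mem_singleton_self v)

theorem isConstOn_iff_label (hσ : σ ∈ K.faces) :
    K.IsConstOn ε σ ↔ ∀ a ∈ σ, ∀ b ∈ σ, label K ε a = label K ε b := by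
  constructor
  · intro h a ha b hb
    simpa only [apply_singleton_eq_label] using
      h ⟨{a}, singleton_mem_faces hσ ha, rfl⟩ ⟨{b}, singleton_mem_faces hσ hb, rfl⟩
        (Finset.singleton_subset_iff.2 ha) (Finset.singleton_subset_iff.2 hb)
  · intro h a b ha hb
    obtain ⟨v, hv⟩ := nonempty_of_mem_faces a.2.1
    obtain ⟨w, hw⟩ := nonempty_of_mem_faces b.2.1
    rw [apply_eq_label (ε := ε) a hv, apply_eq_label (ε := ε) b hw]
    exact h v (ha hv) w (hb hw)

theorem separates_iff_label (hσ : σ ∈ K.faces) {f : E →ᵃ[ℝ] ℝ} :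
    K.Separates ε σ f ↔
      ∀ v ∈ σ, (label K ε v = 1 → 0 < f v) ∧ (label K ε v = 0 → f v < 0) := by
  constructor
  · intro h v hv
    simpa only [apply_singleton_eq_label] using
      h ⟨{v}, singleton_mem_faces hσ hv, rfl⟩ v (Finset.mem_singleton_self v) hv
  · intro h a v hva hv
    rw [apply_eq_label (ε := ε) a hva]
    exact h v hv

theorem coboundary_ne_zero_iff (σ : K.Simplices (0 + 1)) :
    K.coboundary ε σ ≠ 0 ↔ ∃ a ∈ σ.1, ∃ b ∈ σ.1, label K ε a ≠ label K ε b := by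
  classical
  obtain ⟨s, hs, hcard⟩ := σ
  obtain ⟨a, b, hab, rfl⟩ := Finset.card_eq_two.1 hcard
  have ha : a ∈ ({a, b} : Finset E) := Finset.mem_insert_self a {b}
  have hb : b ∈ ({a, b} : Finset E) := Finset.mem_insert_of_mem (Finset.mem_singleton_self b)
  have huniv : (Finset.univ : Finset {v : E // v ∈ ({a, b} : Finset E)}) =
      {⟨a, ha⟩, ⟨b, hb⟩} := by
    ext ⟨v, hv⟩
    simpa only [Finset.mem_univ, true_iff, Finset.mem_insert, Finset.mem_singleton,
      Subtype.mk.injEq] using hv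
  have hsum : K.coboundary ε ⟨{a, b}, hs, hcard⟩ = label K ε b + label K ε a := by
    rw [coboundary, huniv, Finset.sum_pair (by simpa using hab)]
    exact congrArg₂ _ (apply_eq_label _ (Finset.mem_erase.2 ⟨hab.symm, hb⟩))
      (apply_eq_label _ (Finset.mem_erase.2 ⟨hab, ha⟩))
  have hzmod : ∀ x y : ZMod 2, y + x ≠ 0 ↔ x ≠ y := by decide
  rw [hsum, hzmod]
  simp [eq_comm]

end Labels

section DualSpace

open Geometry SimplicialComplex

theorem exists_affineMap_eq_of_affineIndependent {k V F ι : Type*} [DivisionRing k]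
    [AddCommGroup V] [Module k V] [AddCommGroup F] [Module k F] {p : ι → V}
    (hp : AffineIndependent k p) (c : ι → F) : ∃ f : V →ᵃ[k] F, ∀ i, f (p i) = c i := by
  rcases isEmpty_or_nonempty ι with h | ⟨⟨i₀⟩⟩
  · exact ⟨AffineMap.const k V 0, h.elim⟩
  let b := Module.Basis.span ((affineIndependent_iff_linearIndependent_vsub k p i₀).1 hp)
  obtain ⟨L, hL⟩ := (b.constr ℕ fun i => c i - c i₀).exists_extend
  have hvsub (i : ι) : L (p i - p i₀) = c i - c i₀ := by
    rcases eq_or_ne i i₀ with rfl | hi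
    · simp
    · have hb := LinearMap.congr_fun hL (b ⟨i, hi⟩)
      rwa [b.constr_basis, LinearMap.comp_apply, Submodule.subtype_apply,
        Module.Basis.span_apply] at hb
  refine ⟨L.toAffineMap + AffineMap.const k V (c i₀ - L (p i₀)), fun i => ?_⟩
  calc L (p i) + (c i₀ - L (p i₀)) = L (p i - p i₀) + c i₀ := by rw [map_sub]; abel
    _ = c i := by rw [hvsub, sub_add_cancel]

variable {E : Type*} [AddCommGroup E] [Module ℝ E] {K : SimplicialComplex ℝ E} {ε : K.Cochain 0}
  {σ τ : Finset E} {w w' : E → ℝ} {x : E} {f : E →ᵃ[ℝ] ℝ}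

namespace IsBarycentric

theorem eq_of_affineIndependent (hσ : AffineIndependent ℝ ((↑) : σ → E))
    (h : IsBarycentric σ w x) (h' : IsBarycentric σ w' x) : w = w' := by
  have heq := hσ.eq_of_sum_eq_sum (s := Finset.univ) (w₁ := fun v : σ => w v)
    (w₂ := fun v : σ => w' v)
    (by rw [Finset.sum_coe_sort σ w, Finset.sum_coe_sort σ w', h.sum_eq_one, h'.sum_eq_one])
    (by rw [Finset.sum_coe_sort σ fun v => w v • v, Finset.sum_coe_sort σ fun v => w' v • v,
      h.sum_smul_eq, h'.sum_smul_eq])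
  funext v
  by_cases hv : v ∈ σ
  · exact heq ⟨v, hv⟩ (Finset.mem_univ _)
  · rw [h.eq_zero v hv, h'.eq_zero v hv]

theorem eq_of_mem_faces (hσ : σ ∈ K.faces) (hτ : τ ∈ K.faces) (h : IsBarycentric σ w x)
    (h' : IsBarycentric τ w' x) : w = w' := by
  classical
  have hx := K.inter_subset_convexHull hσ hτ ⟨mem_convexHull_iff_exists_isBarycentric.2 ⟨w, h⟩,
    mem_convexHull_iff_exists_isBarycentric.2 ⟨w', h'⟩⟩
  rw [← Finset.coe_inter, mem_convexHull_iff_exists_isBarycentric] at hx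
  obtain ⟨w₀, h₀⟩ := hx
  exact (h.eq_of_affineIndependent (K.indep hσ) (h₀.mono Finset.inter_subset_left)).trans
    ((h₀.mono Finset.inter_subset_right).eq_of_affineIndependent (K.indep hτ) h')

end IsBarycentric

theorem exists_forall_subset_of_isChain {α : Type*} {c : Finset (Finset α)}
    (hc : IsChain (· ⊆ ·) (c : Set (Finset α))) (hne : c.Nonempty) : ∃ M ∈ c, ∀ τ ∈ c, τ ⊆ M := by
  obtain ⟨M, hM, hmax⟩ := c.exists_maximal hne
  exact ⟨M, hM, fun τ hτ => (hc.total hτ hM).elim id (hmax hτ)⟩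

theorem exists_label_ne_of_mem_dualSpace (hσ : σ ∈ K.faces) (h : IsBarycentric σ w x)
    (hx : x ∈ K.dualSpace ε) :
    ∃ a b, label K ε a ≠ label K ε b ∧ (∀ v, w v ≤ w a) ∧ ∀ v, w v ≤ w b := by
  simp only [dualSpace, mem_iUnion] at hx
  obtain ⟨s, ⟨-, c, hc, ⟨σ₀, hσ₀, hmin, hcob⟩, hs⟩, hxs⟩ := hx
  obtain ⟨a, ha, b, hb, hab⟩ := (coboundary_ne_zero_iff σ₀).1 hcob
  obtain ⟨M, hM, hmax⟩ := exists_forall_subset_of_isChain hc.2 ⟨_, hσ₀⟩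
  obtain ⟨w', h', hle⟩ := exists_isBarycentric_of_mem_convexHull_flagSimplex hmax hmin ⟨a, ha⟩
    (convexHull_mono (Finset.coe_subset.2 hs) hxs)
  obtain rfl := h.eq_of_mem_faces hσ (hc.1 hM) h'
  exact ⟨a, b, hab, hle a ha, hle b hb⟩

/-- The superlevel sets of `w` form a flag whose members all contain the edge `{a, b}`, so that
this edge can be put below the flag. -/
theorem mem_dualSpace_of_label_ne (hσ : σ ∈ K.faces) (h : IsBarycentric σ w x) {a b : E}
    (hab : label K ε a ≠ label K ε b) (ha : ∀ v, w v ≤ w a) (hb : ∀ v, w v ≤ w b) :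
    x ∈ K.dualSpace ε := by
  classical
  have hedge {τ : Finset E} : {a, b} ⊆ τ ↔ a ∈ τ ∧ b ∈ τ := by
    rw [Finset.insert_subset_iff, Finset.singleton_subset_iff]
  have hface : {a, b} ∈ K.faces := K.down_closed hσ
    (hedge.2 ⟨h.mem_of_forall_le ha, h.mem_of_forall_le hb⟩) (Finset.insert_nonempty a {b})
  set c := (σ.image w).image (superlevel σ w) with hc
  have hcσ : ∀ τ ∈ c, {a, b} ⊆ τ ∧ τ ⊆ σ := by
    simp only [hc, Finset.forall_mem_image]
    exact fun v _ => ⟨hedge.2 ⟨Finset.mem_filter.2 ⟨h.mem_of_forall_le ha, ha v⟩,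
      Finset.mem_filter.2 ⟨h.mem_of_forall_le hb, hb v⟩⟩, superlevel_subset σ w _⟩
  have hchain : IsChain (· ⊆ ·) (c : Set (Finset E)) :=
    (superlevel_antitone σ w).isChain_range.mono (by
      rw [hc, Finset.coe_image]
      exact image_subset_range _ _)
  simp only [dualSpace, mem_iUnion]
  refine ⟨flagSimplex c, ⟨((h.nonempty.image w).image _).image _, insert {a, b} c, ⟨?_, ?_⟩,
    ⟨⟨{a, b}, hface, Finset.card_pair fun hne => hab (hne ▸ rfl)⟩, Finset.mem_insert_self _ _,
      ?_, ?_⟩, Finset.image_subset_image (Finset.subset_insert _ _)⟩,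
    h.mem_convexHull_flagSimplex_superlevel⟩
  · rw [Finset.coe_insert, insert_subset_iff]
    exact ⟨hface, fun τ hτ => K.down_closed hσ (hcσ τ hτ).2
      ((Finset.insert_nonempty a {b}).mono (hcσ τ hτ).1)⟩
  · rw [Finset.coe_insert]
    exact hchain.insert fun τ hτ _ => Or.inl (hcσ τ hτ).1
  · exact Finset.forall_mem_insert _ _ _ |>.2 ⟨subset_rfl, fun τ hτ => (hcσ τ hτ).1⟩
  · exact (coboundary_ne_zero_iff _).2 ⟨a, by simp, b, by simp, hab⟩

theorem mem_dualSpace_iff (hσ : σ ∈ K.faces) (h : IsBarycentric σ w x) :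
    x ∈ K.dualSpace ε ↔
      ∃ a b, label K ε a ≠ label K ε b ∧ (∀ v, w v ≤ w a) ∧ ∀ v, w v ≤ w b :=
  ⟨exists_label_ne_of_mem_dualSpace hσ h, fun ⟨_, _, hab, ha, hb⟩ =>
    mem_dualSpace_of_label_ne hσ h hab ha hb⟩

theorem exists_separates (hσ : σ ∈ K.faces) : ∃ f : E →ᵃ[ℝ] ℝ, K.Separates ε σ f := by
  obtain ⟨f, hf⟩ := exists_affineMap_eq_of_affineIndependent (K.indep hσ)
    fun v => if label K ε v = 1 then (1 : ℝ) else -1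
  refine ⟨f, (separates_iff_label hσ).2 fun v hv => ?_⟩
  have hfv : f v = if label K ε v = 1 then 1 else -1 := hf ⟨v, hv⟩
  exact ⟨fun h1 => by simp [hfv, h1], fun h0 => by simp [hfv, h0]⟩

theorem apply_pos_iff_label_eq_one (hσ : σ ∈ K.faces) (hf : K.Separates ε σ f) {v : E}
    (hv : v ∈ σ) : 0 < f v ↔ label K ε v = 1 := by
  obtain ⟨h1, h0⟩ := (separates_iff_label hσ).1 hf v hv
  refine ⟨fun hpos => ?_, h1⟩
  exact (Fin.exists_fin_two.1 ⟨label K ε v, rfl⟩).elim (fun h => absurd (h0 h) hpos.not_gt) id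

theorem apply_ne_zero_of_separates (hσ : σ ∈ K.faces) (hf : K.Separates ε σ f) {v : E}
    (hv : v ∈ σ) : f v ≠ 0 := by
  obtain ⟨h1, h0⟩ := (separates_iff_label hσ).1 hf v hv
  exact (Fin.exists_fin_two.1 ⟨label K ε v, rfl⟩).elim (fun h => (h0 h).ne) fun h => (h1 h).ne'

theorem label_ne_iff (hσ : σ ∈ K.faces) (hf : K.Separates ε σ f) {a b : E} (ha : a ∈ σ)
    (hb : b ∈ σ) : label K ε a ≠ label K ε b ↔ ¬(0 < f a ↔ 0 < f b) := by
  have hzmod : ∀ x y : ZMod 2, x ≠ y ↔ ¬(x = 1 ↔ y = 1) := by decide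
  rw [hzmod, apply_pos_iff_label_eq_one hσ hf ha, apply_pos_iff_label_eq_one hσ hf hb]

theorem exists_exists_not_iff_and_iff {α : Type*} {P Q : α → Prop} :
    (∃ a b, ¬(P a ↔ P b) ∧ Q a ∧ Q b) ↔ (∃ a, P a ∧ Q a) ∧ ∃ b, ¬P b ∧ Q b := by
  grind

theorem not_isConstOn_iff_of_separates (hσ : σ ∈ K.faces) (hf : K.Separates ε σ f) :
    ¬K.IsConstOn ε σ ↔ (∃ a, 0 < f a ∧ a ∈ σ) ∧ ∃ b, ¬0 < f b ∧ b ∈ σ := by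
  rw [isConstOn_iff_label hσ, ← exists_exists_not_iff_and_iff]
  simp only [not_forall, exists_prop]
  exact ⟨fun ⟨a, ha, b, hb, hab⟩ => ⟨a, b, (label_ne_iff hσ hf ha hb).1 hab, ha, hb⟩,
    fun ⟨a, b, hab, ha, hb⟩ => ⟨a, ha, b, hb, (label_ne_iff hσ hf ha hb).2 hab⟩⟩

theorem mem_dualSpace_iff_of_separates (hσ : σ ∈ K.faces) (hf : K.Separates ε σ f)
    (h : IsBarycentric σ w x) :
    x ∈ K.dualSpace ε ↔
      (∃ a, 0 < f a ∧ ∀ v, w v ≤ w a) ∧ ∃ b, ¬0 < f b ∧ ∀ v, w v ≤ w b := by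
  rw [mem_dualSpace_iff hσ h, ← exists_exists_not_iff_and_iff]
  refine exists₂_congr fun a b => and_congr_left fun ⟨ha, hb⟩ => ?_
  exact label_ne_iff hσ hf (h.mem_of_forall_le ha) (h.mem_of_forall_le hb)

end DualSpace

section ExtendByZero

variable {α : Type*} {σ : Finset α}

/-- The extension by `0` of coordinates on the vertex set `σ`, the form in which `IsBarycentric`
expects them. -/
noncomputable def extendByZero (w : σ → ℝ) : α → ℝ :=
  Function.extend (↑) w 0

theorem extendByZero_coe (w : σ → ℝ) (v : σ) : extendByZero w v = w v :=
  Subtype.val_injective.extend_apply w 0 v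

theorem extendByZero_of_notMem (w : σ → ℝ) {v : α} (hv : v ∉ σ) : extendByZero w v = 0 :=
  Function.extend_apply' _ _ _ fun ⟨i, hi⟩ => hv (hi ▸ i.2)

theorem extendByZero_injective :
    Function.Injective (extendByZero : (σ → ℝ) → α → ℝ) := fun w w' h => by
  funext v
  rw [← extendByZero_coe w, h, extendByZero_coe]

end ExtendByZero

section SimplexEquiv

open Geometry SimplicialComplex

variable {E : Type*} [AddCommGroup E] [Module ℝ E] {K : SimplicialComplex ℝ E} {ε : K.Cochain 0}
  {σ : Finset E} {f : E →ᵃ[ℝ] ℝ}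

theorem isBarycentric_extendByZero (w : stdSimplex ℝ σ) :
    IsBarycentric σ (extendByZero w.1) (∑ v : σ, w.1 v • (v : E)) where
  nonneg v := by
    by_cases hv : v ∈ σ
    · exact (w.2.1 ⟨v, hv⟩).trans_eq (extendByZero_coe w.1 ⟨v, hv⟩).symm
    · exact (extendByZero_of_notMem w.1 hv).ge
  eq_zero v := extendByZero_of_notMem w.1
  sum_eq_one := by
    rw [← Finset.sum_coe_sort]
    simpa only [extendByZero_coe] using w.2.2
  sum_smul_eq := by
    rw [← Finset.sum_coe_sort]
    simp only [extendByZero_coe]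

/-- The parametrization of a simplex by barycentric coordinates. -/
noncomputable def simplexEquiv (hσ : AffineIndependent ℝ ((↑) : σ → E)) :
    stdSimplex ℝ σ ≃ convexHull ℝ (σ : Set E) :=
  Equiv.ofBijective (fun w => ⟨∑ v : σ, w.1 v • (v : E),
    mem_convexHull_iff_exists_isBarycentric.2 ⟨_, isBarycentric_extendByZero w⟩⟩) <| by
    constructor
    · intro w w' h
      have heq : ∑ v : σ, w.1 v • (v : E) = ∑ v : σ, w'.1 v • (v : E) := Subtype.ext_iff.1 h
      exact Subtype.ext <| extendByZero_injective <|
        (heq ▸ isBarycentric_extendByZero w).eq_of_affineIndependent hσ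
          (isBarycentric_extendByZero w')
    · rintro ⟨x, hx⟩
      obtain ⟨w, hw⟩ := mem_convexHull_iff_exists_isBarycentric.1 hx
      exact ⟨⟨fun v => w v, fun v => hw.nonneg v, (Finset.sum_coe_sort σ w).trans hw.sum_eq_one⟩,
        Subtype.ext ((Finset.sum_coe_sort σ fun v => w v • v).trans hw.sum_smul_eq)⟩

theorem isBarycentric_simplexEquiv (hσ : AffineIndependent ℝ ((↑) : σ → E))
    (w : stdSimplex ℝ σ) :
    IsBarycentric σ (extendByZero w.1) (simplexEquiv hσ w : E) :=
  isBarycentric_extendByZero w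

theorem affineMap_simplexEquiv (hσ : AffineIndependent ℝ ((↑) : σ → E)) (w : stdSimplex ℝ σ)
    (f : E →ᵃ[ℝ] ℝ) : f (simplexEquiv hσ w) = ∑ v : σ, f v * w.1 v := by
  change f (∑ v : σ, w.1 v • (v : E)) = _
  rw [f.decomp]
  simp only [Pi.add_apply, map_sum, map_smul, smul_eq_mul, add_mul, Finset.sum_add_distrib,
    ← Finset.mul_sum]
  rw [w.2.2, mul_one]
  simp only [mul_comm]

theorem forall_extendByZero_le_iff (w : stdSimplex ℝ σ) (a : E) :
    (∀ v, extendByZero w.1 v ≤ extendByZero w.1 a) ↔ ∃ h : a ∈ σ, ∀ i, w.1 i ≤ w.1 ⟨a, h⟩ := by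
  have hw := isBarycentric_extendByZero w
  constructor
  · intro h
    have ha := hw.mem_of_forall_le h
    refine ⟨ha, fun i => ?_⟩
    rw [← extendByZero_coe w.1 i, ← extendByZero_coe w.1 ⟨a, ha⟩]
    exact h i
  · rintro ⟨ha, h⟩ v
    rw [extendByZero_coe w.1 ⟨a, ha⟩]
    by_cases hv : v ∈ σ
    · exact (extendByZero_coe w.1 ⟨v, hv⟩).trans_le (h _)
    · exact (extendByZero_of_notMem w.1 hv).trans_le (w.2.1 _)

theorem simplexEquiv_mem_dualSpace_iff (hσ : σ ∈ K.faces) (hf : K.Separates ε σ f)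
    (w : stdSimplex ℝ σ) :
    (simplexEquiv (K.indep hσ) w : E) ∈ K.dualSpace ε ↔
      (∃ a : σ, 0 < f a ∧ ∀ i, w.1 i ≤ w.1 a) ∧ ∃ b : σ, ¬0 < f b ∧ ∀ i, w.1 i ≤ w.1 b := by
  rw [mem_dualSpace_iff_of_separates hσ hf (isBarycentric_simplexEquiv (K.indep hσ) w)]
  simp only [forall_extendByZero_le_iff, Subtype.exists, exists_and_left]

theorem simplexEquiv_mem_dualSpace_iff_balanceHomeo (hσ : σ ∈ K.faces) (hf : K.Separates ε σ f)
    (hf0 : ∀ v : σ, f v ≠ 0) (w : stdSimplex ℝ σ) :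
    (simplexEquiv (K.indep hσ) w : E) ∈ K.dualSpace ε ↔
      ∑ v : σ, f v * (balanceHomeo hf0 1 w).1 v = 0 := by
  rw [simplexEquiv_mem_dualSpace_iff hσ hf, sum_mul_balanceHomeo_one_eq_zero_iff]

variable [TopologicalSpace E] [ContinuousAdd E] [ContinuousSMul ℝ E]

theorem continuous_simplexEquiv (hσ : AffineIndependent ℝ ((↑) : σ → E)) :
    Continuous (simplexEquiv hσ) :=
  Continuous.subtype_mk (continuous_finsetSum _ fun v _ =>
    ((continuous_apply v).comp continuous_subtype_val).smul continuous_const) _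

theorem isotopicWithin_of_separates [T2Space E] (hσ : σ ∈ K.faces) (hf : K.Separates ε σ f) :
    IsotopicWithin {x : convexHull ℝ (σ : Set E) | x.1 ∈ K.dualSpace ε}
      {x : convexHull ℝ (σ : Set E) | f x.1 = 0} := by
  have hf0 : ∀ v : σ, f v ≠ 0 := fun v => apply_ne_zero_of_separates hσ hf v.2
  let φ : stdSimplex ℝ σ ≃ₜ convexHull ℝ (σ : Set E) :=
    (continuous_simplexEquiv (K.indep hσ)).homeoOfEquivCompactToT2
  let H (t : unitInterval) := (φ.symm.trans (balanceHomeo hf0 t)).trans φ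
  have hH (x) : x.1 ∈ K.dualSpace ε ↔ f (H 1 x) = 0 := by
    obtain ⟨w, rfl⟩ := φ.surjective x
    refine (simplexEquiv_mem_dualSpace_iff_balanceHomeo hσ hf hf0 w).trans ?_
    rw [← affineMap_simplexEquiv (K.indep hσ)]
    change _ ↔ f (φ (balanceHomeo hf0 1 (φ.symm (φ w)))) = 0
    rw [φ.symm_apply_apply]
    rfl
  refine ⟨H, ?_, ?_, ?_⟩
  · exact φ.continuous.comp ((continuous_balanceHomeo hf0).comp
      (continuous_fst.prodMk (φ.symm.continuous.comp continuous_snd)))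
  · ext x
    simp [H, balanceHomeo_zero]
  · calc H 1 '' {x | x.1 ∈ K.dualSpace ε} = H 1 '' (H 1 ⁻¹' {x | f x.1 = 0}) :=
        congrArg _ (Set.ext hH)
      _ = {x | f x.1 = 0} := (H 1).surjective.image_preimage _

end SimplexEquiv

section Cells

open Geometry SimplicialComplex

variable {E : Type*} [AddCommGroup E] [Module ℝ E] {K : SimplicialComplex ℝ E} {ε : K.Cochain 0}
  {σ τ : Finset E} {x : K.Polyhedron}

variable (K) in
/-- The relative interior of the simplex with vertex set `σ`, as a subset of the polyhedron. -/
def openSimplex (σ : Finset E) : Set K.Polyhedron :=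
  {x | ∃ w, IsBarycentric σ w x.1 ∧ ∀ v ∈ σ, 0 < w v}

theorem disjoint_openSimplex (hσ : σ ∈ K.faces) (hτ : τ ∈ K.faces) (hne : σ ≠ τ) :
    Disjoint (openSimplex K σ) (openSimplex K τ) := by
  rw [Set.disjoint_left]
  rintro x ⟨w, hw, hpos⟩ ⟨w', hw', hpos'⟩
  obtain rfl := hw.eq_of_mem_faces hσ hτ hw'
  refine hne (Finset.Subset.antisymm (fun v hv => ?_) fun v hv => ?_) <;> by_contra hv'
  · exact (hpos v hv).ne' (hw'.eq_zero v hv')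
  · exact (hpos' v hv).ne' (hw.eq_zero v hv')

theorem exists_ssubset_mem_closedSimplex (hx : x ∈ K.closedSimplex σ)
    (hxσ : x ∉ openSimplex K σ) : ∃ τ ⊂ σ, τ.Nonempty ∧ x ∈ K.closedSimplex τ := by
  classical
  obtain ⟨w, hw⟩ := mem_convexHull_iff_exists_isBarycentric.1 hx
  obtain ⟨i, hi, hwi⟩ : ∃ i ∈ σ, w i ≤ 0 := by
    by_contra! hpos
    exact hxσ ⟨w, hw, hpos⟩
  have hw' : IsBarycentric (σ.erase i) w x.1 := hw.restrict (Finset.erase_subset i σ)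
    fun v hv hvi => by
      obtain rfl : v = i := by_contra fun h => hvi (Finset.mem_erase.2 ⟨h, hv⟩)
      exact le_antisymm hwi (hw.nonneg v)
  exact ⟨_, Finset.erase_ssubset hi, hw'.nonempty,
    mem_convexHull_iff_exists_isBarycentric.2 ⟨w, hw'⟩⟩

theorem mem_openSimplex_iff_of_eq_simplexEquiv (hσ : AffineIndependent ℝ ((↑) : σ → E))
    {w : stdSimplex ℝ σ} (hx : x.1 = simplexEquiv hσ w) :
    x ∈ openSimplex K σ ↔ ∀ v, 0 < w.1 v := by
  have hw := isBarycentric_simplexEquiv hσ w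
  rw [← hx] at hw
  constructor
  · rintro ⟨w', hw', hpos⟩ v
    rw [← extendByZero_coe w.1 v, hw.eq_of_affineIndependent hσ hw']
    exact hpos v v.2
  · intro hpos
    exact ⟨_, hw, fun v hv => (hpos ⟨v, hv⟩).trans_eq (extendByZero_coe w.1 ⟨v, hv⟩).symm⟩

theorem exists_partialEquiv_of_compactSpace {X Y : Type*} [TopologicalSpace X]
    [TopologicalSpace Y] [T2Space Y] {s t : Set X} [CompactSpace s] [Nonempty s] (hts : t ⊆ s)
    {ψ : s → Y} (hψ : Continuous ψ) (hinj : Function.Injective ψ) :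
    ∃ e : PartialEquiv X Y, (∀ x : s, e x = ψ x) ∧ e.source = t ∧
      ContinuousOn e.symm e.target := by
  obtain ⟨x₀⟩ := ‹Nonempty s›
  have : Nonempty X := ⟨x₀⟩
  set Φ : X → Y := Function.extend (↑) ψ fun _ => ψ x₀
  have hΦ (x : s) : Φ x = ψ x := Subtype.val_injective.extend_apply _ _ x
  have hΦinj : InjOn Φ t := fun x hx y hy hxy => Subtype.ext_iff.1 <| hinj
    (a₁ := ⟨x, hts hx⟩) (a₂ := ⟨y, hts hy⟩) <| by rw [← hΦ, ← hΦ, hxy]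
  set e := hΦinj.toPartialEquiv Φ t
  have hsymm : Continuous fun y : e.target => (⟨e.symm y, hts (e.map_target y.2)⟩ : s) := by
    rw [(hψ.isClosedEmbedding hinj).isInducing.continuous_iff]
    exact continuous_subtype_val.congr fun y =>
      (e.right_inv y.2).symm.trans (hΦ ⟨e.symm y, hts (e.map_target y.2)⟩)
  exact ⟨e, hΦ, rfl, continuousOn_iff_continuous_domRestrict.2
    (continuous_subtype_val.comp hsymm)⟩

variable [TopologicalSpace E]

theorem continuous_simplexInclusion (σ : K.faces) : Continuous (K.simplexInclusion σ) :=
  continuous_iff_coinduced_le.2 (le_iSup (fun σ : K.faces =>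
    TopologicalSpace.coinduced (K.simplexInclusion σ) inferInstance) σ)

variable [ContinuousAdd E] [ContinuousSMul ℝ E]

theorem exists_closedBall_parametrization_dualSubset {p : ℕ} (hσ : σ ∈ K.faces)
    (hcard : σ.card = p + 2) (hε : ¬K.IsConstOn ε σ) :
    ∃ ψ : Metric.closedBall (0 : Fin p → ℝ) 1 → K.Polyhedron, Continuous ψ ∧
      Function.Injective ψ ∧ range ψ = K.dualSubset ε ∩ K.closedSimplex σ ∧
      ∀ u, ψ u ∈ openSimplex K σ ↔ u.1 ∈ Metric.ball 0 1 := by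
  obtain ⟨f, hf⟩ := exists_separates (ε := ε) hσ
  have hf0 : ∀ v : σ, f v ≠ 0 := fun v => apply_ne_zero_of_separates hσ hf v.2
  obtain ⟨⟨a, hfa, ha⟩, b, hfb, hb⟩ := (not_isConstOn_iff_of_separates hσ hf).1 hε
  obtain ⟨g, hg, hginj, hgrange, hgball⟩ := exists_closedBall_parametrization hf0 (a := ⟨a, ha⟩)
    (b := ⟨b, hb⟩) hfa ((not_lt.1 hfb).lt_of_ne (hf0 ⟨b, hb⟩))
    ((Fintype.card_coe σ).trans hcard)
  let h := balanceHomeo hf0 1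
  let j (w : stdSimplex ℝ σ) : K.Polyhedron :=
    K.simplexInclusion ⟨σ, hσ⟩ (simplexEquiv (K.indep hσ) w)
  have hj : Continuous j := (continuous_simplexInclusion ⟨σ, hσ⟩).comp (continuous_simplexEquiv _)
  have hjinj : Function.Injective j := fun w w' hww' =>
    (simplexEquiv (K.indep hσ)).injective <|
      Subtype.ext (show (j w).1 = (j w').1 from congrArg _ hww')
  have hjrange : range j = K.closedSimplex σ := by
    ext x
    refine ⟨?_, fun hx => ⟨(simplexEquiv (K.indep hσ)).symm ⟨x.1, hx⟩, ?_⟩⟩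
    · rintro ⟨w, rfl⟩
      exact (simplexEquiv (K.indep hσ) w).2
    · exact Subtype.ext (by simp [j, simplexInclusion])
  have hjdual (w) : j w ∈ K.dualSubset ε ↔ h w ∈ range g := by
    rw [hgrange]
    exact simplexEquiv_mem_dualSpace_iff_balanceHomeo hσ hf hf0 w
  refine ⟨j ∘ h.symm ∘ g, hj.comp (h.symm.continuous.comp hg),
    hjinj.comp (h.symm.injective.comp hginj), ?_, fun u => ?_⟩
  · rw [← hjrange, range_comp, range_comp, h.image_symm, ← image_preimage_eq_inter_range]
    exact congrArg _ (Set.ext fun w => (hjdual w).symm)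
  · rw [← hgball, mem_openSimplex_iff_of_eq_simplexEquiv (K.indep hσ) rfl]
    refine forall_congr' fun v => ?_
    rw [← h.apply_symm_apply (g u), balanceHomeo_apply_pos_iff]
    rfl

theorem exists_partialEquiv_dualSubset [T2Space E] {p : ℕ} (hσ : σ ∈ K.faces)
    (hcard : σ.card = p + 2) (hε : ¬K.IsConstOn ε σ) :
    ∃ e : PartialEquiv (Fin p → ℝ) K.Polyhedron, e.source = Metric.ball 0 1 ∧
      ContinuousOn e (Metric.closedBall 0 1) ∧ ContinuousOn e.symm e.target ∧
      e '' Metric.closedBall 0 1 = K.dualSubset ε ∩ K.closedSimplex σ ∧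
      ∀ u ∈ Metric.closedBall 0 1, e u ∈ openSimplex K σ ↔ u ∈ Metric.ball 0 1 := by
  obtain ⟨ψ, hψ, hinj, hrange, hball⟩ := exists_closedBall_parametrization_dualSubset hσ hcard hε
  have : CompactSpace (Metric.closedBall (0 : Fin p → ℝ) 1) :=
    isCompact_iff_compactSpace.1 (isCompact_closedBall _ _)
  have : Nonempty (Metric.closedBall (0 : Fin p → ℝ) 1) := ⟨0, by simp⟩
  obtain ⟨e, heψ, hsource, hsymm⟩ :=
    exists_partialEquiv_of_compactSpace Metric.ball_subset_closedBall hψ hinj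
  refine ⟨e, hsource, ?_, hsymm, ?_, fun u hu => ?_⟩
  · exact continuousOn_iff_continuous_domRestrict.2 (hψ.congr fun u => (heψ u).symm)
  · rw [← hrange, image_eq_range]
    exact congrArg range (funext heψ)
  · exact heψ ⟨u, hu⟩ ▸ hball ⟨u, hu⟩

end Cells

section CWComplex

open Geometry SimplicialComplex

variable {E : Type*} [AddCommGroup E] [Module ℝ E] {K : SimplicialComplex ℝ E} {ε : K.Cochain 0}
  {σ τ : Finset E} {p q : ℕ}

variable (K ε) in
/-- The index type of the `p`-cells of `V_ε`: the `(p + 1)`-simplices on which `ε` is not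
constant. -/
abbrev DualCell (p : ℕ) :=
  {σ : K.Simplices (p + 1) // ¬K.IsConstOn ε σ.1}

theorem not_isConstOn_of_mem (hσ : σ ∈ K.faces) {x : K.Polyhedron} (hx : x ∈ K.dualSubset ε)
    (hxσ : x ∈ K.closedSimplex σ) : ¬K.IsConstOn ε σ := by
  obtain ⟨w, hw⟩ := mem_convexHull_iff_exists_isBarycentric.1 hxσ
  obtain ⟨a, b, hab, ha, hb⟩ := exists_label_ne_of_mem_dualSpace hσ hw hx
  exact fun h => hab <|
    (isConstOn_iff_label hσ).1 h a (hw.mem_of_forall_le ha) b (hw.mem_of_forall_le hb)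

theorem exists_dualCell_of_not_isConstOn (hσ : σ ∈ K.faces) (hε : ¬K.IsConstOn ε σ) :
    ∃ p, ∃ c : DualCell K ε p, c.1.1 = σ := by
  have hcard : 1 < σ.card := by
    rw [isConstOn_iff_label hσ] at hε
    push Not at hε
    obtain ⟨a, ha, b, hb, hab⟩ := hε
    exact Finset.one_lt_card.2 ⟨a, ha, b, hb, fun h => hab (h ▸ rfl)⟩
  obtain ⟨p, hp⟩ := Nat.exists_eq_add_of_le' hcard
  exact ⟨p, ⟨⟨σ, hσ, hp⟩, hε⟩, rfl⟩

theorem exists_dualCell_of_mem (hσ : σ ∈ K.faces) {x : K.Polyhedron} (hx : x ∈ K.dualSubset ε)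
    (hxσ : x ∈ K.closedSimplex σ) : ∃ p, ∃ c : DualCell K ε p, c.1.1 = σ :=
  exists_dualCell_of_not_isConstOn hσ (not_isConstOn_of_mem hσ hx hxσ)

theorem sigma_ext_of_dualCell {c : DualCell K ε p} {d : DualCell K ε q} (h : c.1.1 = d.1.1) :
    (⟨p, c⟩ : Σ p, DualCell K ε p) = ⟨q, d⟩ := by
  obtain rfl : p = q := by
    have hcard := c.1.2.2.symm.trans ((congrArg Finset.card h).trans d.1.2.2)
    omega
  rw [Subtype.ext (Subtype.ext h)]

theorem finite_setOf_dualCell_subset (σ : Finset E) (q : ℕ) :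
    {d : DualCell K ε q | d.1.1 ⊆ σ}.Finite :=
  (σ.powerset.finite_toSet.preimage fun _ _ _ _ h => Subtype.ext (Subtype.ext h)).subset
    fun _ hd => Finset.mem_coe.2 (Finset.mem_powerset.2 hd)

variable [TopologicalSpace E] [ContinuousAdd E] [ContinuousSMul ℝ E] [T2Space E]

/-- The characteristic map of a cell of `V_ε`. -/
noncomputable def dualCellMap (c : DualCell K ε p) : PartialEquiv (Fin p → ℝ) K.Polyhedron :=
  (exists_partialEquiv_dualSubset c.1.2.1 c.1.2.2 c.2).choose

theorem dualCellMap_source (c : DualCell K ε p) : (dualCellMap c).source = Metric.ball 0 1 :=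
  (exists_partialEquiv_dualSubset c.1.2.1 c.1.2.2 c.2).choose_spec.1

theorem continuousOn_dualCellMap (c : DualCell K ε p) :
    ContinuousOn (dualCellMap c) (Metric.closedBall 0 1) :=
  (exists_partialEquiv_dualSubset c.1.2.1 c.1.2.2 c.2).choose_spec.2.1

theorem continuousOn_dualCellMap_symm (c : DualCell K ε p) :
    ContinuousOn (dualCellMap c).symm (dualCellMap c).target :=
  (exists_partialEquiv_dualSubset c.1.2.1 c.1.2.2 c.2).choose_spec.2.2.1

theorem dualCellMap_image_closedBall (c : DualCell K ε p) :
    dualCellMap c '' Metric.closedBall 0 1 = K.dualSubset ε ∩ K.closedSimplex c.1.1 :=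
  (exists_partialEquiv_dualSubset c.1.2.1 c.1.2.2 c.2).choose_spec.2.2.2.1

theorem dualCellMap_mem_openSimplex_iff (c : DualCell K ε p) {u : Fin p → ℝ}
    (hu : u ∈ Metric.closedBall 0 1) :
    dualCellMap c u ∈ openSimplex K c.1.1 ↔ u ∈ Metric.ball 0 1 :=
  (exists_partialEquiv_dualSubset c.1.2.1 c.1.2.2 c.2).choose_spec.2.2.2.2 u hu

theorem dualCellMap_image_ball_subset (c : DualCell K ε p) :
    dualCellMap c '' Metric.ball 0 1 ⊆ openSimplex K c.1.1 :=
  image_subset_iff.2 fun _ hu =>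
    (dualCellMap_mem_openSimplex_iff c (Metric.ball_subset_closedBall hu)).2 hu

theorem disjoint_dualCellMap_image_ball {c : DualCell K ε p} {d : DualCell K ε q}
    (hcd : c.1.1 ≠ d.1.1) :
    Disjoint (dualCellMap c '' Metric.ball 0 1) (dualCellMap d '' Metric.ball 0 1) :=
  (disjoint_openSimplex c.1.2.1 d.1.2.1 hcd).mono (dualCellMap_image_ball_subset c)
    (dualCellMap_image_ball_subset d)

theorem exists_dualCellMap_image_of_mem_sphere (c : DualCell K ε p) {u : Fin p → ℝ}
    (hu : u ∈ Metric.sphere 0 1) :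
    ∃ q < p, ∃ d : DualCell K ε q, d.1.1 ⊆ c.1.1 ∧
      dualCellMap c u ∈ dualCellMap d '' Metric.closedBall 0 1 := by
  have hu' := Metric.sphere_subset_closedBall hu
  obtain ⟨hx, hxc⟩ := (dualCellMap_image_closedBall c).subset (mem_image_of_mem _ hu')
  have hopen : dualCellMap c u ∉ openSimplex K c.1.1 := by
    rw [dualCellMap_mem_openSimplex_iff c hu', Metric.mem_ball]
    exact (Metric.mem_sphere.1 hu).not_lt
  obtain ⟨τ, hτc, hτne, hxτ⟩ := exists_ssubset_mem_closedSimplex hxc hopen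
  obtain ⟨q, d, rfl⟩ := exists_dualCell_of_mem (K.down_closed c.1.2.1 hτc.1 hτne) hx hxτ
  have hqp : q < p := by
    have hcard := Finset.card_lt_card hτc
    rw [d.1.2.2, c.1.2.2] at hcard
    omega
  exact ⟨q, hqp, d, hτc.1, (dualCellMap_image_closedBall d).superset ⟨hx, hxτ⟩⟩

theorem isClosed_of_forall_dualCell {A : Set K.Polyhedron} (hA : A ⊆ K.dualSubset ε)
    (hclosed : ∀ p, ∀ c : DualCell K ε p,
      IsClosed (A ∩ dualCellMap c '' Metric.closedBall 0 1)) : IsClosed A := by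
  refine (K.isClosed_polyhedron_iff A).2 fun σ => ?_
  by_cases hε : K.IsConstOn ε σ.1
  · convert isClosed_empty
    exact eq_empty_of_forall_notMem fun x hx => not_isConstOn_of_mem σ.2 (hA hx) x.2 hε
  · obtain ⟨p, c, hc⟩ := exists_dualCell_of_not_isConstOn σ.2 hε
    convert (hclosed p c).preimage (continuous_simplexInclusion σ) using 1
    rw [dualCellMap_image_closedBall, hc]
    exact Set.ext fun x => ⟨fun hx => ⟨hx, hA hx, x.2⟩, And.left⟩

theorem iUnion_dualCellMap_image_closedBall :
    ⋃ (p) (c : DualCell K ε p), dualCellMap c '' Metric.closedBall 0 1 = K.dualSubset ε := by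
  simp only [dualCellMap_image_closedBall]
  refine Subset.antisymm (iUnion₂_subset fun _ _ => inter_subset_left) fun x hx => ?_
  obtain ⟨σ, hσ, hxσ⟩ := mem_space_iff.1 x.2
  obtain ⟨p, c, rfl⟩ := exists_dualCell_of_mem hσ hx hxσ
  exact mem_iUnion₂.2 ⟨p, c, hx, hxσ⟩

variable (K ε) in
/-- The CW structure on `V_ε` whose cells are the intersections of `V_ε` with the simplices on
which `ε` is not constant. -/
noncomputable instance dualCWComplex : Topology.CWComplex (K.dualSubset ε) where
  cell := DualCell K ε
  map _ := dualCellMap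
  source_eq _ := dualCellMap_source
  continuousOn _ := continuousOn_dualCellMap
  continuousOn_symm _ := continuousOn_dualCellMap_symm
  pairwiseDisjoint' _ _ _ _ hcd :=
    disjoint_dualCellMap_image_ball fun h => hcd (sigma_ext_of_dualCell h)
  mapsTo' p c := by
    classical
    refine ⟨fun q => (finite_setOf_dualCell_subset c.1.1 q).toFinset, fun u hu => ?_⟩
    obtain ⟨q, hq, d, hd, hud⟩ := exists_dualCellMap_image_of_mem_sphere c hu
    exact mem_iUnion₂.2 ⟨q, hq, mem_iUnion₂.2 ⟨d, (Set.Finite.mem_toFinset _).2 hd, hud⟩⟩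
  closed' _ hA hclosed := isClosed_of_forall_dualCell hA hclosed
  union' := iUnion_dualCellMap_image_closedBall

end CWComplex

end CocycleDual

theorem mainTheorem9_general {E : Type u} [AddCommGroup E] [Module ℝ E] [TopologicalSpace E]
    [ContinuousAdd E] [ContinuousSMul ℝ E] [T2Space E]
    (K : Geometry.SimplicialComplex ℝ E) (ε : K.Cochain 0) :
    (∀ σ ∈ K.faces,
      (∃ f : E →ᵃ[ℝ] ℝ, K.Separates ε σ f) ∧
      ∀ f : E →ᵃ[ℝ] ℝ, K.Separates ε σ f →
        IsotopicWithin {x : convexHull ℝ (σ : Set E) | x.1 ∈ K.dualSpace ε}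
          {x : convexHull ℝ (σ : Set E) | f x.1 = 0}) ∧
    ∃ (_ : Topology.CWComplex (K.dualSubset ε))
      (e : ∀ p : ℕ, Topology.CWComplex.cell (K.dualSubset ε) p ≃
        {σ : K.Simplices (p + 1) // ¬ K.IsConstOn ε σ.1}),
      ∀ (p : ℕ) (c : Topology.CWComplex.cell (K.dualSubset ε) p),
        Topology.CWComplex.closedCell (C := K.dualSubset ε) p c =
          K.dualSubset ε ∩ K.closedSimplex (e p c).1.1 :=
  ⟨fun _ hσ => ⟨CocycleDual.exists_separates hσ,
      fun _ hf => CocycleDual.isotopicWithin_of_separates hσ hf⟩,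
    CocycleDual.dualCWComplex K ε, fun _ => Equiv.refl _,
    fun _ c => CocycleDual.dualCellMap_image_closedBall c⟩

theorem mainTheorem9 {E : Type u} [AddCommGroup E] [Module ℝ E] [TopologicalSpace E]
    [IsTopologicalAddGroup E] [ContinuousSMul ℝ E] [T2Space E]
    (K : Geometry.SimplicialComplex ℝ E) (hK : K.IsLocallyFinite) (ε : K.Cochain 0) :
    (∀ σ ∈ K.faces, (K.dualSpace ε ∩ convexHull ℝ (σ : Set E)).Nonempty →
      (∃ f : E →ᵃ[ℝ] ℝ, K.Separates ε σ f) ∧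
      ∀ f : E →ᵃ[ℝ] ℝ, K.Separates ε σ f →
        IsotopicWithin {x : convexHull ℝ (σ : Set E) | x.1 ∈ K.dualSpace ε}
          {x : convexHull ℝ (σ : Set E) | f x.1 = 0}) ∧
    ∃ (_ : Topology.CWComplex (K.dualSubset ε))
      (e : ∀ p : ℕ, Topology.CWComplex.cell (K.dualSubset ε) p ≃
        {σ : K.Simplices (p + 1) // ¬ K.IsConstOn ε σ.1}),
      ∀ (p : ℕ) (c : Topology.CWComplex.cell (K.dualSubset ε) p),
        Topology.CWComplex.closedCell (C := K.dualSubset ε) p c =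
          K.dualSubset ε ∩ K.closedSimplex (e p c).1.1 :=
  (mainTheorem9_general K ε).imp_left fun h σ hσ _ => h σ hσ
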